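/- **Setting.** Let $L\ge 1$, $H,W\ge 1$, let $C=C_0,C_1,\dots,C_{L-1},K,N\ge 0$ be integers, and let $\lambda\ge 0$. Consider the $L$-layer linear convolutional network $$f_w(x)=w^{L,T}\bigl(w^{L-1}*\cdots *w^1 * x\bigr),\qquad f_w:\mathbb R^{C\times H\times W}\to\mathbb R^K,$$ with real weights $w^l\in\mathbb R^{C_l\times H\times W\times C_{l-1}}$ ($1\le l\le L-1$) and $w^L\in\mathbb R^{K\times H\times W\times C_{L-1}}$. The spatial indices are taken modulo $H$ and modulo $W$, and $$(w*x)_{cij}=\sum_{m+m'=i,\ n+n'=j}\ \sum_d w_{cmnd}\,x_{dm'n'},\qquad (u^{T}x)_k=\sum_{d,m,n}u_{kmnd}\,x_{dmn}$$ (the second formula is used for real and for complex tensors). Let $\hat{\ }$ be the unitary discrete Fourier transform in the two spatial indices, $$\hat x_{cij}=\frac1{\sqrt{HW}}\sum_{m,n}x_{cmn}\,e^{-2\pi\imath mi/H-2\pi\imath nj/W},$$ and similarly for $w$. Let $$\hat f_{\hat w}(\hat x)=\hat w^{L,T}\bigl(\hat w^{L-1}\cdots\hat w^1\cdot\hat x\bigr),\qquad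 (\hat w\cdot\hat x)_{cij}=\sum_d\hat w_{cijd}\,\hat x_{dij},$$ be the corresponding network in frequency space. Fix data $x^1,\dots,x^N\in\mathbb R^{C\times H\times W}$ and $y^1,\dots,y^N\in\mathbb R^K$, and an arbitrary loss function $\mathcal L:(\mathbb R^K)^N\times(\mathbb R^K)^N\to\mathbb R$. For a complex $K\times C$ matrix $A$ with singular values $\sigma_1,\dots,\sigma_{\min\{K,C\}}$ and $p>0$ put $\|A\|^S_p=(\sum_i\sigma_i^p)^{1/p}$. Let $\mathcal V$ be the set of all $\hat v\in\mathbb C^{K\times H\times W\times C}$ that are Fourier transforms of real tensors and all of whose $K\times C$ blocks $\hat v_{ij}$ (obtained by fixing the spatial indices) have rank at most $\min\{C,C_1,\dots,C_{L-1},K\}$. **Theorem.** For all real $w$, all $\hat v\in\mathcal V$ and all real $x$, the vectors $\hat f_{\hat w}(\hat x)$ and $\hat v^T\hat x$ are real, and the following holds. 1. The problem $$\min_{\hat w}\ \mathcal L\bigl((\hat f_{\hat w}(\hat x^n))_{n},(y^n)_{n}\bigr)+\lambda\sum_{l=1}^L\|\hat w^l\|_2^2$$ over the Fourier transforms $\hat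 w$ of real weights $w$ is equivalent to $$\min_{\hat v\in\mathcal V}\ \mathcal L\bigl((\hat v^T\hat x^n)_{n},(y^n)_{n}\bigr)+\lambda L\sum_{i,j}\bigl(\|\hat v_{ij}\|^S_{2/L}\bigr)^{2/L},$$ where $\hat w$ corresponds to $\hat v$ if $\hat f_{\hat w}(\hat x)=\hat v^T\hat x$ for all real $x$. 2. The problem $$\min_{w}\ \mathcal L\bigl((f_w(x^n))_{n},(y^n)_{n}\bigr)+\lambda\sum_{l=1}^L\|w^l\|_2^2$$ over real weights $w$ is equivalent to $$\min_{\hat v\in\mathcal V}\ \mathcal L\bigl((\hat v^T\hat x^n)_{n},(y^n)_{n}\bigr)+\lambda L\,(HW)^{-\frac{L-1}{L}}\sum_{i,j}\bigl(\|\hat v_{ij}\|^S_{2/L}\bigr)^{2/L},$$ where $w$ corresponds to $\hat v$ if $f_w(x)=\hat v^T\hat x$ for all real $x$. Here *equivalent* means the following. Every choice of weights corresponds to exactly one $\hat v\in\mathcal V$. For every $\hat v\in\mathcal V$, the value of the second objective at $\hat v$ is the minimum of the first objective over all weights that correspond to $\hat v$. The two problems have the same infimum in $[-\infty,\infty]$,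 and one has a minimum if and only if the other does, with the same value. Minimizing weights correspond to a minimizing $\hat v$, and every minimizing $\hat v$ corresponds to some minimizing weights. -/

import Mathlib

noncomputable section

namespace LinearCNN

/-- A multichannel image with `c` channels and circular spatial indices, `x_{c i j}`. -/
abbrev Image (R : Type) (c H W : ℕ) : Type := Fin c → ZMod H → ZMod W → R

/-- A tensor `w_{c i j d}` with `a` output channels, spatial indices in `ℤ/H × ℤ/W`, and
`b` input channels. -/
abbrev Tensor (R : Type) (a H W b : ℕ) : Type := Fin a → ZMod H → ZMod W → Fin b → R

section Operations

variable {R : Type} {a b H W : ℕ} [NeZero H] [NeZero W]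

/-- Full `H × W` circular convolution:
`(w * x)_{c i j} = ∑_{m + m' = i, n + n' = j} ∑_d w_{c m n d} x_{d m' n'}`. -/
def conv [CommSemiring R] (w : Tensor R a H W b) (x : Image R b H W) : Image R a H W :=
  fun c i j => ∑ m, ∑ n, ∑ d, w c m n d * x d (i - m) (j - n)

/-- Spatially pointwise matrix-vector product: `(w · x)_{c i j} = ∑_d w_{c i j d} x_{d i j}`. -/
def pointwise [CommSemiring R] (w : Tensor R a H W b) (x : Image R b H W) : Image R a H W :=
  fun c i j => ∑ d, w c i j d * x d i j

/-- The (bilinear) contraction `(wᵀ x)_c = ∑_{i, j, d} w_{c i j d} x_{d i j}`. -/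
def contract [CommSemiring R] (w : Tensor R a H W b) (x : Image R b H W) : Fin a → R :=
  fun c => ∑ i, ∑ j, ∑ d, w c i j d * x d i j

/-- Squared Euclidean norm of a tensor. -/
def sqNorm [Norm R] (w : Tensor R a H W b) : ℝ :=
  ∑ c, ∑ i, ∑ j, ∑ d, ‖w c i j d‖ ^ 2

/-- The kernel of the unitary two-dimensional discrete Fourier transform,
`exp (-2πι m i / H - 2πι n j / W) / √(H W)`. -/
def dftKernel (m i : ZMod H) (n j : ZMod W) : ℂ :=
  ((1 / Real.sqrt ((H : ℝ) * W) : ℝ) : ℂ) *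
    (ZMod.stdAddChar (-(m * i)) * ZMod.stdAddChar (-(n * j)))

/-- Discrete Fourier transform of a real image over its two spatial indices. -/
def dftImage (x : Image ℝ a H W) : Image ℂ a H W :=
  fun c i j => ∑ m, ∑ n, (x c m n : ℂ) * dftKernel m i n j

/-- Discrete Fourier transform of a real tensor over its two spatial indices. -/
def dftTensor (w : Tensor ℝ a H W b) : Tensor ℂ a H W b :=
  fun c i j d => ∑ m, ∑ n, (w c m n d : ℂ) * dftKernel m i n j

/-- The matrix obtained by fixing the spatial indices of a tensor. -/
def block (v : Tensor R a H W b) (i : ZMod H) (j : ZMod W) : Matrix (Fin a) (Fin b) R :=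
  Matrix.of fun c d => v c i j d

end Operations

/-- The Schatten `p`-(quasi-)norm `(∑_{i < min (a, b)} σ_i ^ p) ^ (1 / p)`, where
`σ_0 ≥ σ_1 ≥ …` are the singular values of the complex `a × b` matrix `A`. -/
def schatten {a b : ℕ} (p : ℝ) (A : Matrix (Fin a) (Fin b) ℂ) : ℝ :=
  (∑ i ∈ Finset.range (min a b), (Matrix.toEuclideanLin A).singularValues i ^ p) ^ (1 / p)

/-- Weights of a network with `n` convolutional layers and one final contraction, hence of depth
`L = n + 1`. `C 0` is the number of input channels, `C 1, …, C n` are the numbers of channels of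
the hidden layers, and `K` is the number of outputs. -/
structure Weights (R : Type) {n : ℕ} (C : Fin (n + 1) → ℕ) (K H W : ℕ) : Type where
  layer : ∀ l : Fin n, Tensor R (C l.succ) H W (C l.castSucc)
  final : Tensor R K H W (C (Fin.last n))

section Networks

variable {n K H W : ℕ} [NeZero H] [NeZero W] {C : Fin (n + 1) → ℕ}

/-- The sum of the squared Euclidean norms of all `L = n + 1` weight tensors. -/
def Weights.sqNormSum {R : Type} [Norm R] (w : Weights R C K H W) : ℝ :=
  (∑ l, sqNorm (w.layer l)) + sqNorm w.final

/-- The discrete Fourier transform of all the weights. -/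
def Weights.dft (w : Weights ℝ C K H W) : Weights ℂ C K H W where
  layer l := dftTensor (w.layer l)
  final := dftTensor w.final

/-- The linear CNN `f (x) = w^{L,T} (w^{L-1} * ⋯ * w^1 * x)`. -/
def Weights.cnn (w : Weights ℝ C K H W) (x : Image ℝ (C 0) H W) : Fin K → ℝ :=
  contract w.final
    (Fin.induction (motive := fun l => Image ℝ (C l) H W) x
      (fun l z => conv (w.layer l) z) (Fin.last n))

/-- The frequency space network `w^{L,T} (w^{L-1} · ⋯ · w^1 · x)`, in which the convolutions are
replaced by spatially pointwise products. -/
def Weights.freqNet (w : Weights ℂ C K H W) (x : Image ℂ (C 0) H W) : Fin K → ℂ :=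
  contract w.final
    (Fin.induction (motive := fun l => Image ℂ (C l) H W) x
      (fun l z => pointwise (w.layer l) z) (Fin.last n))

/-- The feasible end-to-end tensors in frequency space: Fourier transforms `v̂` of real
`K × H × W × C` tensors such that each `K × C` block `v̂_{ij}` has rank at most
`min {C, C_1, …, C_{L-1}, K}`. -/
def feasible {n : ℕ} (C : Fin (n + 1) → ℕ) (K H W : ℕ) [NeZero H] [NeZero W] :
    Set (Tensor ℂ K H W (C 0)) :=
  {v | (∃ u : Tensor ℝ K H W (C 0), v = dftTensor u) ∧
    ∀ i j, (block v i j).rank ≤ min (⨅ l, C l) K}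

/-- The sum over all frequencies of the `2/L`-th powers of the Schatten `2/L`-quasi-norms of the
blocks. -/
def schattenPenalty (L : ℕ) {a b : ℕ} (v : Tensor ℂ a H W b) : ℝ :=
  ∑ i, ∑ j, schatten (2 / (L : ℝ)) (block v i j) ^ (2 / (L : ℝ))

end Networks

/-- Minimizing `J` over all of `α` is equivalent to minimizing `J'` over `S`, where `Rep a b` says
that `b` is the variable of the second problem that corresponds to the variable `a` of the first
one. -/
structure EquivalentMinimization {α β : Type} (J : α → ℝ) (S : Set β) (J' : β → ℝ)
    (Rep : α → β → Prop) : Prop where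
  /-- Each `a` corresponds to exactly one feasible `b`. -/
  existsUnique : ∀ a, ∃! b, b ∈ S ∧ Rep a b
  /-- The value `J' b` is the minimum of `J` over all `a` that correspond to `b`. -/
  isLeast_fiber : ∀ b ∈ S, IsLeast (J '' {a | Rep a b}) (J' b)
  /-- The infima agree (also if they are `-∞`). -/
  iInf_eq : (⨅ a, (J a : EReal)) = ⨅ b ∈ S, (J' b : EReal)
  /-- The minimum of one problem exists if and only if the other one does, with the same value. -/
  isLeast_iff : ∀ m, IsLeast (Set.range J) m ↔ IsLeast (J' '' S) m
  /-- Minimizers of the first problem yield minimizers of the second one. -/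
  minimizer_of : ∀ a, IsMinOn J Set.univ a → ∀ b ∈ S, Rep a b → IsMinOn J' S b
  /-- Every minimizer of the second problem comes from a minimizer of the first one. -/
  exists_minimizer : ∀ b ∈ S, IsMinOn J' S b → ∃ a, Rep a b ∧ IsMinOn J Set.univ a

end LinearCNN

end

/-!
In frequency space a network acts at each frequency `q` as a product of `L` matrices, so
everything reduces to one block `A` of rank at most every layer width: the least `∑ ‖Mₗ‖²` among
the factorizations `A = M_L ⋯ M₁` is `L ∑ σᵢ ^ (2 / L)`. For the lower bound, transport the right
singular vectors through the layers, orthonormalizing by Gram–Schmidt at each layer; the diagonal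
entries of the resulting triangular matrices multiply up to the `σᵢ`, and AM–GM applies. Equality
holds when the singular value decomposition of `A` is spread evenly over the layers. Real weights
are those whose factors at `-q` are conjugate to those at `q`, and optimal factors can be chosen in
this way. Each convolution contributes a factor `√(HW)` in frequency space, so the second problem
is the first one after rescaling all layers equally and reflecting the last one.
-/

noncomputable section

namespace LinearCNN

open InnerProductSpace Matrix ComplexConjugate

section GramSchmidt

variable {𝕜 E F ι : Type*} [RCLike 𝕜] [NormedAddCommGroup E] [InnerProductSpace 𝕜 E]
  [NormedAddCommGroup F] [InnerProductSpace 𝕜 F]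

section Basic

variable [LinearOrder ι] [LocallyFiniteOrderBot ι] [WellFoundedLT ι]

theorem inner_gramSchmidt_self (f : ι → E) (i : ι) :
    inner 𝕜 (gramSchmidt 𝕜 f i) (f i) = (‖gramSchmidt 𝕜 f i‖ : 𝕜) ^ 2 := by
  conv_lhs => rw [gramSchmidt_def'' 𝕜 f i]
  rw [inner_add_right, inner_sum, inner_self_eq_norm_sq_to_K, Finset.sum_eq_zero, add_zero]
  intro j hj
  rw [inner_smul_right, gramSchmidt_orthogonal 𝕜 f (Finset.mem_Iio.1 hj).ne', mul_zero]

theorem sub_gramSchmidt_mem_span (f : ι → E) (i : ι) :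
    f i - gramSchmidt 𝕜 f i ∈ Submodule.span 𝕜 (f '' Set.Iio i) := by
  rw [← span_gramSchmidt_Iio 𝕜 f i]
  nth_rewrite 1 [gramSchmidt_def'' 𝕜 f i]
  rw [add_sub_cancel_left]
  exact Submodule.sum_mem _ fun j hj => Submodule.smul_mem _ _
    (Submodule.subset_span ⟨j, Finset.mem_Iio.1 hj, rfl⟩)

theorem norm_gramSchmidt_map_le (T : E →ₗ[𝕜] F) (f : ι → E) (i : ι) :
    ‖gramSchmidt 𝕜 (fun j => T (f j)) i‖ ≤ ‖T (gramSchmidt 𝕜 f i)‖ := by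
  set g := gramSchmidt 𝕜 (fun j => T (f j)) i
  have inner_map_span : ∀ x ∈ Submodule.span 𝕜 (f '' Set.Iio i), inner 𝕜 g (T x) = 0 := by
    intro x hx
    induction hx using Submodule.span_induction with
    | mem x hx =>
      obtain ⟨j, hj, rfl⟩ := hx
      exact gramSchmidt_inv_triangular 𝕜 (fun j => T (f j)) hj
    | zero => rw [map_zero, inner_zero_right]
    | add x y _ _ hx hy => rw [map_add, inner_add_right, hx, hy, add_zero]
    | smul a x _ hx => rw [map_smul, inner_smul_right, hx, mul_zero]
  have inner_map : inner 𝕜 g (T (gramSchmidt 𝕜 f i)) = (‖g‖ : 𝕜) ^ 2 := by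
    rw [← inner_gramSchmidt_self (fun j => T (f j)) i, ← sub_eq_zero, ← inner_sub_right,
      ← map_sub, ← neg_sub, map_neg, inner_neg_right,
      inner_map_span _ (sub_gramSchmidt_mem_span f i), neg_zero]
  have cauchy_schwarz := norm_inner_le_norm (𝕜 := 𝕜) g (T (gramSchmidt 𝕜 f i))
  rw [inner_map, norm_pow, RCLike.norm_ofReal, abs_norm, sq] at cauchy_schwarz
  rcases (norm_nonneg g).eq_or_lt with h | h
  · exact h ▸ norm_nonneg _
  · exact le_of_mul_le_mul_left cauchy_schwarz h

theorem norm_smul_gramSchmidtNormed (f : ι → E) (i : ι) :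
    (‖gramSchmidt 𝕜 f i‖ : 𝕜) • gramSchmidtNormed 𝕜 f i = gramSchmidt 𝕜 f i := by
  by_cases h : gramSchmidt 𝕜 f i = 0
  · rw [gramSchmidtNormed, h, smul_zero, smul_zero]
  · rw [gramSchmidtNormed, smul_smul, mul_inv_cancel₀ (by simpa using h), one_smul]

theorem norm_gramSchmidt_map_le_mul (T : E →ₗ[𝕜] F) (f : ι → E) (i : ι) :
    ‖gramSchmidt 𝕜 (fun j => T (f j)) i‖
      ≤ ‖gramSchmidt 𝕜 f i‖ * ‖T (gramSchmidtNormed 𝕜 f i)‖ := by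
  refine (norm_gramSchmidt_map_le T f i).trans_eq ?_
  conv_lhs => rw [← norm_smul_gramSchmidtNormed f i, map_smul, norm_smul]
  rw [RCLike.norm_ofReal, abs_norm]

end Basic

theorem sum_norm_inner_gramSchmidtNormed_le [LinearOrder ι] [LocallyFiniteOrderBot ι] [Fintype ι]
    (f : ι → E) (x : E) : ∑ i, ‖inner 𝕜 (gramSchmidtNormed 𝕜 f i) x‖ ^ 2 ≤ ‖x‖ ^ 2 := by
  classical
  refine le_trans (le_of_eq ?_)
    ((gramSchmidtNormed_orthonormal' (𝕜 := 𝕜) f).sum_inner_products_le x (s := Finset.univ))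
  rw [← Finset.sum_subset (Finset.filter_subset
    (fun i => gramSchmidtNormed 𝕜 f i ≠ 0) Finset.univ)]
  · exact Finset.sum_subtype _ (by simp) _
  · intro i _ hi
    have : gramSchmidtNormed 𝕜 f i = 0 := by simpa using hi
    rw [this, inner_zero_left, norm_zero, zero_pow two_ne_zero]

end GramSchmidt

section Columns

variable {𝕜 m n ρ : Type*} [RCLike 𝕜]

/-- The columns of a matrix as vectors of a Euclidean space. -/
def colVec (V : Matrix m ρ 𝕜) (i : ρ) : EuclideanSpace 𝕜 m :=
  WithLp.toLp 2 (V.col i)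

theorem toEuclideanLin_colVec [Fintype n] [DecidableEq n] (A : Matrix m n 𝕜) (V : Matrix n ρ 𝕜)
    (i : ρ) : toEuclideanLin A (colVec V i) = colVec (A * V) i :=
  rfl

theorem colVec_mul_diagonal [Fintype ρ] [DecidableEq ρ] (U : Matrix m ρ 𝕜) (d : ρ → 𝕜) (i : ρ) :
    colVec (U * diagonal d) i = d i • colVec U i := by
  ext c
  simp [colVec, mul_comm]

theorem inner_colVec [Fintype m] (V : Matrix m ρ 𝕜) (i j : ρ) :
    inner 𝕜 (colVec V i) (colVec V j) = (Vᴴ * V) i j := by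
  simp [colVec, PiLp.inner_apply, mul_apply, mul_comm]

theorem orthonormal_colVec_iff [Fintype m] [DecidableEq ρ] {V : Matrix m ρ 𝕜} :
    Orthonormal 𝕜 (colVec V) ↔ Vᴴ * V = 1 := by
  simp only [orthonormal_iff_ite, inner_colVec, ← Matrix.ext_iff, one_apply]

end Columns

section Frobenius

open scoped Matrix.Norms.Frobenius

variable {𝕜 m n ρ : Type*} [RCLike 𝕜] [Fintype m] [Fintype n] [Fintype ρ]

theorem frobenius_norm_sq {R : Type*} [SeminormedAddCommGroup R] (A : Matrix m n R) :
    ‖A‖ ^ 2 = ∑ i, ∑ j, ‖A i j‖ ^ 2 := by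
  rw [frobenius_norm_def, ← Real.sqrt_eq_rpow, Real.sq_sqrt (by positivity)]
  simp only [Real.rpow_two]

theorem frobenius_norm_sq_eq_trace (A : Matrix m n 𝕜) : ((‖A‖ ^ 2 : ℝ) : 𝕜) = (Aᴴ * A).trace := by
  rw [frobenius_norm_sq, Finset.sum_comm]
  simp [trace, mul_apply, RCLike.conj_mul]

theorem frobenius_norm_mul_left [DecidableEq n] {P : Matrix m n 𝕜} (hP : Pᴴ * P = 1)
    (A : Matrix n ρ 𝕜) : ‖P * A‖ = ‖A‖ := by
  rw [← sq_eq_sq₀ (norm_nonneg _) (norm_nonneg _), ← RCLike.ofReal_inj (K := 𝕜),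
    frobenius_norm_sq_eq_trace, frobenius_norm_sq_eq_trace, conjTranspose_mul, Matrix.mul_assoc,
    ← Matrix.mul_assoc Pᴴ, hP, Matrix.one_mul]

theorem frobenius_norm_mul_conjTranspose [DecidableEq n] {Q : Matrix m n 𝕜} (hQ : Qᴴ * Q = 1)
    (A : Matrix ρ n 𝕜) : ‖A * Qᴴ‖ = ‖A‖ := by
  rw [← frobenius_norm_conjTranspose, conjTranspose_mul, conjTranspose_conjTranspose,
    frobenius_norm_mul_left hQ, frobenius_norm_conjTranspose]

theorem frobenius_norm_sq_mul_diagonal_mul [DecidableEq ρ] {P : Matrix m ρ 𝕜} {Q : Matrix n ρ 𝕜}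
    (hP : Pᴴ * P = 1) (hQ : Qᴴ * Q = 1) (t : ρ → ℝ) :
    ‖P * diagonal (fun i => (t i : 𝕜)) * Qᴴ‖ ^ 2 = ∑ i, t i ^ 2 := by
  rw [frobenius_norm_mul_conjTranspose hQ, frobenius_norm_mul_left hP, frobenius_norm_diagonal,
    EuclideanSpace.norm_sq_eq]
  simp only [RCLike.norm_ofReal, sq_abs]

theorem sum_norm_toEuclideanLin_gramSchmidtNormed_le [DecidableEq n] [LinearOrder ρ]
    [LocallyFiniteOrderBot ρ] (A : Matrix m n 𝕜) (f : ρ → EuclideanSpace 𝕜 n) :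
    ∑ i, ‖toEuclideanLin A (gramSchmidtNormed 𝕜 f i)‖ ^ 2 ≤ ‖A‖ ^ 2 := by
  simp only [EuclideanSpace.norm_sq_eq, frobenius_norm_sq]
  rw [Finset.sum_comm]
  refine Finset.sum_le_sum fun c _ => ?_
  have bessel := sum_norm_inner_gramSchmidtNormed_le (𝕜 := 𝕜) f
    (WithLp.toLp 2 fun d => star (A c d))
  simp only [EuclideanSpace.norm_sq_eq, norm_star] at bessel
  refine le_trans (le_of_eq (Finset.sum_congr rfl fun i _ => ?_)) bessel
  rw [← norm_inner_symm, EuclideanSpace.inner_eq_star_dotProduct]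
  simp [mulVec, dotProduct, mul_comm]

end Frobenius

section MatrixChain

/-- A composable sequence of `n` matrices followed by a final one: the linear network that a
convolutional network of depth `n + 1` induces at a single frequency. -/
structure MatrixChain (R : Type*) {n : ℕ} (ι : Fin (n + 1) → Type*) (κ : Type*) where
  layer : ∀ l : Fin n, Matrix (ι l.succ) (ι l.castSucc) R
  final : Matrix κ (ι (Fin.last n)) R

namespace MatrixChain

variable {R S κ : Type*} {n : ℕ} {ι : Fin (n + 1) → Type*}

/-- The matrices of a chain with a ring homomorphism applied to all entries. -/
def map [Semiring R] [Semiring S] (φ : R →+* S) (M : MatrixChain R ι κ) : MatrixChain S ι κ where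
  layer l := (M.layer l).map φ
  final := M.final.map φ

theorem map_map_of_involutive [Semiring R] {φ : R →+* R} (hφ : Function.Involutive φ)
    (M : MatrixChain R ι κ) : (M.map φ).map φ = M := by
  simp only [map, Matrix.map_map, hφ.comp_self, Matrix.map_id]

variable [∀ l, Fintype (ι l)]

section Product

variable [DecidableEq (ι 0)]

/-- The product `M_{l-1} ⋯ M_0` of the first `l` matrices of a chain. -/
def partialProd [Semiring R] (M : MatrixChain R ι κ) (l : Fin (n + 1)) : Matrix (ι l) (ι 0) R :=
  Fin.induction (motive := fun l => Matrix (ι l) (ι 0) R) 1 (fun l P => M.layer l * P) l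

/-- The product of all the matrices of a chain. -/
def prod [Semiring R] (M : MatrixChain R ι κ) : Matrix κ (ι 0) R :=
  M.final * M.partialProd (Fin.last n)

theorem partialProd_zero [Semiring R] (M : MatrixChain R ι κ) : M.partialProd 0 = 1 := rfl

theorem partialProd_succ [Semiring R] (M : MatrixChain R ι κ) (l : Fin n) :
    M.partialProd l.succ = M.layer l * M.partialProd l.castSucc := rfl

theorem map_partialProd [Semiring R] [Semiring S] (φ : R →+* S) (M : MatrixChain R ι κ)
    (l : Fin (n + 1)) : (M.map φ).partialProd l = (M.partialProd l).map φ := by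
  induction l using Fin.induction with
  | zero => rw [partialProd_zero, partialProd_zero, Matrix.map_one _ φ.map_zero φ.map_one]
  | succ l ih => rw [partialProd_succ, partialProd_succ, ih, Matrix.map_mul, map]

theorem map_prod [Semiring R] [Semiring S] (φ : R →+* S) (M : MatrixChain R ι κ) :
    (M.map φ).prod = M.prod.map φ := by
  rw [prod, prod, map_partialProd, Matrix.map_mul, map]

theorem rank_partialProd_le [Field R] (M : MatrixChain R ι κ) {k l : Fin (n + 1)} (hk : k ≤ l) :
    (M.partialProd l).rank ≤ Fintype.card (ι k) := by
  induction l using Fin.induction generalizing k with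
  | zero =>
    obtain rfl : k = 0 := Fin.le_zero_iff.1 hk
    exact rank_le_card_height _
  | succ l ih =>
    rcases hk.eq_or_lt with rfl | h
    · exact rank_le_card_height _
    · exact (rank_mul_le_right _ _).trans (ih (Fin.le_castSucc_iff.2 h))

theorem rank_prod_le [Field R] (M : MatrixChain R ι κ) (l : Fin (n + 1)) :
    M.prod.rank ≤ Fintype.card (ι l) :=
  (rank_mul_le_right _ _).trans (M.rank_partialProd_le (Fin.le_last l))

end Product

section Norm

open scoped Matrix.Norms.Frobenius

variable [Fintype κ]

/-- The sum of the squared Frobenius norms of the matrices of a chain. -/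
def sqNormSum [SeminormedAddCommGroup R] (M : MatrixChain R ι κ) : ℝ :=
  ∑ l, ‖M.layer l‖ ^ 2 + ‖M.final‖ ^ 2

theorem sqNormSum_map {R S : Type*} [SeminormedRing R] [SeminormedRing S] {φ : R →+* S}
    (hφ : ∀ x, ‖φ x‖ = ‖x‖) (M : MatrixChain R ι κ) : (M.map φ).sqNormSum = M.sqNormSum := by
  simp only [sqNormSum, map, frobenius_norm_map_eq _ φ hφ]

end Norm

end MatrixChain

end MatrixChain

section ThinSVD

variable {𝕜 m n ρ : Type*} [RCLike 𝕜] [Fintype m] [Fintype n] [Fintype ρ] [DecidableEq ρ]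

/-- A singular value decomposition `A = U diag(s) Vᴴ` in which only some of the singular vectors
are listed; the singular values that belong to the other ones vanish. -/
structure IsThinSVD (A : Matrix m n 𝕜) (U : Matrix m ρ 𝕜) (s : ρ → ℝ) (V : Matrix n ρ 𝕜) :
    Prop where
  nonneg : ∀ i, 0 ≤ s i
  left : Uᴴ * U = 1
  right : Vᴴ * V = 1
  eq : A = U * diagonal (fun i => (s i : 𝕜)) * Vᴴ

namespace IsThinSVD

variable {A : Matrix m n 𝕜} {U : Matrix m ρ 𝕜} {s : ρ → ℝ} {V : Matrix n ρ 𝕜}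

theorem mul_right_eq (h : IsThinSVD A U s V) : A * V = U * diagonal (fun i => (s i : 𝕜)) := by
  rw [h.eq, Matrix.mul_assoc, h.right, Matrix.mul_one]

theorem conjTranspose_mul_self (h : IsThinSVD A U s V) :
    Aᴴ * A = V * (diagonal (fun i => ((s i ^ 2 : ℝ) : 𝕜)) * Vᴴ) := by
  have hD : (diagonal fun i => (s i : 𝕜))ᴴ * diagonal (fun i => (s i : 𝕜))
      = diagonal fun i => ((s i ^ 2 : ℝ) : 𝕜) := by
    rw [diagonal_conjTranspose, diagonal_mul_diagonal]
    simp [sq]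
  rw [h.eq, conjTranspose_mul, conjTranspose_mul, conjTranspose_conjTranspose, ← hD]
  simp only [Matrix.mul_assoc]
  rw [← Matrix.mul_assoc Uᴴ, h.left, Matrix.one_mul]

theorem map_sq_singularValues_eq {U' : Matrix m ρ 𝕜} {s' : ρ → ℝ} {V' : Matrix n ρ 𝕜}
    (h : IsThinSVD A U s V) (h' : IsThinSVD A U' s' V') :
    Finset.univ.val.map (fun i => s i ^ 2) = Finset.univ.val.map (fun i => s' i ^ 2) := by
  classical
  have charpoly_eq {U : Matrix m ρ 𝕜} {s : ρ → ℝ} {V : Matrix n ρ 𝕜} (h : IsThinSVD A U s V) :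
      Polynomial.X ^ Fintype.card ρ * (Aᴴ * A).charpoly = Polynomial.X ^ Fintype.card n *
        ((Finset.univ.val.map fun i => ((s i ^ 2 : ℝ) : 𝕜)).map
          fun x => Polynomial.X - Polynomial.C x).prod := by
    rw [h.conjTranspose_mul_self, charpoly_mul_comm', Matrix.mul_assoc, h.right, Matrix.mul_one,
      charpoly_diagonal, Multiset.map_map]
    rfl
  have roots_eq := congrArg Polynomial.roots <| mul_left_cancel₀
    (pow_ne_zero _ Polynomial.X_ne_zero) ((charpoly_eq h).symm.trans (charpoly_eq h'))
  rw [Polynomial.roots_multiset_prod_X_sub_C, Polynomial.roots_multiset_prod_X_sub_C] at roots_eq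
  refine Multiset.map_injective (RCLike.ofReal_injective (K := 𝕜)) ?_
  rwa [Multiset.map_map, Multiset.map_map]

theorem sum_comp_eq {U' : Matrix m ρ 𝕜} {s' : ρ → ℝ} {V' : Matrix n ρ 𝕜}
    (h : IsThinSVD A U s V) (h' : IsThinSVD A U' s' V') (f : ℝ → ℝ) :
    ∑ i, f (s i) = ∑ i, f (s' i) := by
  have := congrArg (fun t => (t.map fun x => f √x).sum) (h.map_sq_singularValues_eq h')
  simp only [Multiset.map_map, Function.comp_def, Real.sqrt_sq (h.nonneg _),
    Real.sqrt_sq (h'.nonneg _)] at this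
  exact this

theorem map {𝕜' : Type*} [RCLike 𝕜'] (h : IsThinSVD A U s V) (φ : 𝕜 →+* 𝕜')
    (hstar : ∀ x, φ (star x) = star (φ x)) (hreal : ∀ x : ℝ, φ (x : 𝕜) = x) :
    IsThinSVD (A.map φ) (U.map φ) s (V.map φ) where
  nonneg := h.nonneg
  left := by
    rw [← conjTranspose_map _ hstar, ← Matrix.map_mul, h.left,
      Matrix.map_one _ φ.map_zero φ.map_one]
  right := by
    rw [← conjTranspose_map _ hstar, ← Matrix.map_mul, h.right,
      Matrix.map_one _ φ.map_zero φ.map_one]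
  eq := by
    rw [← conjTranspose_map _ hstar, h.eq, Matrix.map_mul, Matrix.map_mul,
      diagonal_map φ.map_zero]
    simp only [hreal]

theorem rank_eq (h : IsThinSVD A U s V) : A.rank = Fintype.card {i // s i ≠ 0} := by
  have rank_diagonal_eq : (diagonal fun i => (s i : 𝕜)).rank = Fintype.card {i // s i ≠ 0} := by
    simp only [rank_diagonal, ne_eq, RCLike.ofReal_eq_zero]
  rw [← rank_diagonal_eq]
  refine le_antisymm ?_ ?_
  · rw [h.eq]
    exact (rank_mul_le_left _ _).trans (rank_mul_le_right _ _)
  · have : diagonal (fun i => (s i : 𝕜)) = Uᴴ * (A * V) := by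
      rw [h.mul_right_eq, ← Matrix.mul_assoc, h.left, Matrix.one_mul]
    rw [this]
    exact (rank_mul_le_right _ _).trans (rank_mul_le_left _ _)

end IsThinSVD

theorem card_le_of_conjTranspose_mul_self {Q : Matrix m ρ 𝕜} (hQ : Qᴴ * Q = 1) :
    Fintype.card ρ ≤ Fintype.card m := by
  rw [← rank_one (R := 𝕜) (n := ρ), ← hQ]
  exact (rank_mul_le_right _ _).trans (rank_le_card_height _)

end ThinSVD

section Existence

variable {𝕜 E F ι : Type*} [RCLike 𝕜] [NormedAddCommGroup E] [InnerProductSpace 𝕜 E]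
  [NormedAddCommGroup F] [InnerProductSpace 𝕜 F] [FiniteDimensional 𝕜 E]

theorem exists_orthonormal_norm_smul_eq [Fintype ι] {v : ι → E}
    (hv : Pairwise fun i j => inner 𝕜 (v i) (v j) = 0)
    (hcard : Fintype.card ι ≤ Module.finrank 𝕜 E) :
    ∃ u : ι → E, Orthonormal 𝕜 u ∧ ∀ i, v i = (‖v i‖ : 𝕜) • u i := by
  obtain ⟨φ⟩ : Nonempty (ι ↪ Fin (Module.finrank 𝕜 E)) :=
    Function.Embedding.nonempty_of_card_le (by simpa using hcard)
  set w : Fin (Module.finrank 𝕜 E) → E :=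
    Function.extend φ (fun i => ((‖v i‖ : 𝕜)⁻¹) • v i) 0
  have hw : ∀ i, w (φ i) = ((‖v i‖ : 𝕜)⁻¹) • v i := φ.injective.extend_apply _ _
  have orthonormal_w : Orthonormal 𝕜 ((φ '' {i | v i ≠ 0}).domRestrict w) := by
    refine ⟨?_, ?_⟩
    · rintro ⟨_, i, hi, rfl⟩
      rw [Set.domRestrict_apply, hw]
      exact norm_smul_inv_norm hi
    · rintro ⟨_, i, _, rfl⟩ ⟨_, j, _, rfl⟩ hne
      have hij : i ≠ j := fun h => hne (Subtype.ext (congrArg φ h))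
      rw [Set.domRestrict_apply, Set.domRestrict_apply, hw, hw, inner_smul_left, inner_smul_right,
        hv hij, mul_zero, mul_zero]
  obtain ⟨b, hb⟩ := orthonormal_w.exists_orthonormalBasis_extension_of_card_eq (by simp)
  refine ⟨b ∘ φ, b.orthonormal.comp φ φ.injective, fun i => ?_⟩
  by_cases hi : v i = 0
  · simp [hi]
  · rw [Function.comp_apply, hb _ ⟨i, hi, rfl⟩, hw, smul_inv_smul₀ (by simpa using hi)]

variable [FiniteDimensional 𝕜 F]

theorem inner_map_eigenvectorBasis (T : E →ₗ[𝕜] F) {b : ℕ} (hb : Module.finrank 𝕜 E = b)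
    (i j : Fin b) :
    inner 𝕜 (T (T.isSymmetric_adjoint_comp_self.eigenvectorBasis hb i))
        (T (T.isSymmetric_adjoint_comp_self.eigenvectorBasis hb j))
      = if i = j then ((T.singularValues j : ℝ) : 𝕜) ^ 2 else 0 := by
  rw [← LinearMap.adjoint_inner_right, ← LinearMap.comp_apply,
    LinearMap.IsSymmetric.apply_eigenvectorBasis, inner_smul_right, ← T.sq_singularValues_fin hb,
    OrthonormalBasis.inner_eq_ite]
  split_ifs <;> simp

theorem exists_orthonormal_singular_vectors (T : E →ₗ[𝕜] F) {r : ℕ}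
    (hT : Module.finrank 𝕜 T.range ≤ r) (hE : r ≤ Module.finrank 𝕜 E)
    (hF : r ≤ Module.finrank 𝕜 F) :
    ∃ (u : Fin r → F) (v : Fin r → E), Orthonormal 𝕜 u ∧ Orthonormal 𝕜 v ∧
      ∀ x, T x = ∑ i, (inner 𝕜 (v i) x * (T.singularValues i : 𝕜)) • u i := by
  set e := T.isSymmetric_adjoint_comp_self.eigenvectorBasis rfl
  have norm_map : ∀ j, ‖T (e j)‖ = T.singularValues j := fun j => by
    have h := inner_map_eigenvectorBasis T rfl j j
    rw [if_pos rfl, inner_self_eq_norm_sq_to_K] at h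
    exact (sq_eq_sq₀ (norm_nonneg _) (T.singularValues_nonneg _)).1 (by exact_mod_cast h)
  have map_eq_zero : ∀ j : Fin _, r ≤ j → T (e j) = 0 := fun j hj => by
    rw [← norm_eq_zero, norm_map, LinearMap.singularValues_eq_zero_iff_le_finrank_range]
    exact hT.trans hj
  obtain ⟨u, hu, hTu⟩ := exists_orthonormal_norm_smul_eq (𝕜 := 𝕜)
    (v := fun i : Fin r => T (e (Fin.castLE hE i)))
    (fun i j hij => by
      dsimp only
      rw [inner_map_eigenvectorBasis, if_neg ((Fin.castLE_injective hE).ne hij)])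
    (by simpa using hF)
  refine ⟨u, fun i => e (Fin.castLE hE i), hu,
    e.orthonormal.comp _ (Fin.castLE_injective hE), fun x => ?_⟩
  calc T x = ∑ j, inner 𝕜 (e j) x • T (e j) := by
        conv_lhs => rw [← e.sum_repr' x, map_sum]
        simp only [map_smul]
    _ = ∑ i : Fin r, inner 𝕜 (e (Fin.castLE hE i)) x • T (e (Fin.castLE hE i)) := by
        symm
        refine Fintype.sum_of_injective _ (Fin.castLE_injective hE) _ _ (fun j hj => ?_)
          fun _ => rfl
        rw [map_eq_zero j (not_lt.1 fun h => hj ⟨⟨j, h⟩, rfl⟩), smul_zero]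
    _ = _ := Finset.sum_congr rfl fun i _ => by
        rw [hTu i, norm_map, smul_smul, Fin.val_castLE]

end Existence

section MatrixExistence

variable {𝕜 m n : Type*} [RCLike 𝕜] [Fintype n] [DecidableEq n]

theorem finrank_range_toEuclideanLin [Finite m] (A : Matrix m n 𝕜) :
    Module.finrank 𝕜 (toEuclideanLin A).range = A.rank := by
  classical
  have := Fintype.ofFinite m
  exact (rank_eq_finrank_range_toLin A (PiLp.basisFun 2 𝕜 m) (PiLp.basisFun 2 𝕜 n)).symm

theorem exists_isThinSVD [Fintype m] (A : Matrix m n 𝕜) {r : ℕ} (hA : A.rank ≤ r)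
    (hm : r ≤ Fintype.card m) (hn : r ≤ Fintype.card n) :
    ∃ U V, IsThinSVD A U (fun i : Fin r => (toEuclideanLin A).singularValues i) V := by
  obtain ⟨u, v, hu, hv, hT⟩ := exists_orthonormal_singular_vectors (toEuclideanLin A)
    (r := r) (by rwa [finrank_range_toEuclideanLin]) (by simpa using hn) (by simpa using hm)
  refine ⟨of fun c i => u i c, of fun d i => v i d,
    fun i => LinearMap.singularValues_nonneg _ _, orthonormal_colVec_iff.1 hu,
    orthonormal_colVec_iff.1 hv, ?_⟩
  ext c d
  have hTcd := congrArg (fun x => x.ofLp c) (hT (EuclideanSpace.single d 1))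
  rw [mul_apply]
  simpa [mul_diagonal, mul_comm, mul_left_comm, EuclideanSpace.inner_single_right] using hTcd

theorem singularValues_toEuclideanLin_eq_zero [Fintype m] {A : Matrix m n 𝕜} {i : ℕ}
    (hA : A.rank ≤ i) : (toEuclideanLin A).singularValues i = 0 := by
  rwa [LinearMap.singularValues_eq_zero_iff_le_finrank_range, finrank_range_toEuclideanLin]

theorem schatten_rpow {a b : ℕ} {p : ℝ} (hp : 0 < p) (A : Matrix (Fin a) (Fin b) ℂ) :
    schatten p A ^ p
      = ∑ i ∈ Finset.range (min a b), (toEuclideanLin A).singularValues i ^ p := by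
  rw [schatten, ← Real.rpow_mul (Finset.sum_nonneg fun i _ =>
    Real.rpow_nonneg (LinearMap.singularValues_nonneg _ i) _), one_div, inv_mul_cancel₀ hp.ne',
    Real.rpow_one]

theorem IsThinSVD.schatten_rpow {a b r : ℕ} {A : Matrix (Fin a) (Fin b) ℂ}
    {U : Matrix (Fin a) (Fin r) ℂ} {s : Fin r → ℝ} {V : Matrix (Fin b) (Fin r) ℂ}
    (h : IsThinSVD A U s V) {p : ℝ} (hp : 0 < p) : schatten p A ^ p = ∑ i, s i ^ p := by
  have ha : r ≤ a := by simpa using card_le_of_conjTranspose_mul_self h.left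
  have hb : r ≤ b := by simpa using card_le_of_conjTranspose_mul_self h.right
  have hA : A.rank ≤ r := by
    simpa only [h.rank_eq, Fintype.card_fin] using Fintype.card_subtype_le fun i => s i ≠ 0
  obtain ⟨U', V', h'⟩ := exists_isThinSVD A hA (by simpa using ha) (by simpa using hb)
  rw [LinearCNN.schatten_rpow hp, h.sum_comp_eq h' (· ^ p),
    Fin.sum_univ_eq_sum_range (fun i => (toEuclideanLin A).singularValues i ^ p)]
  refine (Finset.sum_subset (Finset.range_mono (le_min ha hb)) fun i _ hi => ?_).symm
  rw [singularValues_toEuclideanLin_eq_zero (hA.trans (by simpa using hi)), Real.zero_rpow hp.ne']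

theorem rank_map_eq {𝕜 𝕜' m n : Type*} [RCLike 𝕜] [RCLike 𝕜'] [Finite m] [Fintype n]
    (A : Matrix m n 𝕜) (φ : 𝕜 →+* 𝕜') (hstar : ∀ x, φ (star x) = star (φ x))
    (hreal : ∀ x : ℝ, φ (x : 𝕜) = x) :
    (A.map φ).rank = A.rank := by
  classical
  have := Fintype.ofFinite m
  obtain ⟨U, V, h⟩ := exists_isThinSVD A le_rfl (rank_le_card_height A) (rank_le_card_width A)
  rw [h.rank_eq, (h.map φ hstar hreal).rank_eq]

end MatrixExistence

section LowerBound

theorem card_mul_prod_rpow_le_sum_sq {ι : Type*} [Fintype ι] [Nonempty ι] {β : ι → ℝ}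
    (hβ : ∀ i, 0 ≤ β i) :
    (Fintype.card ι : ℝ) * (∏ i, β i) ^ (2 / (Fintype.card ι : ℝ)) ≤ ∑ i, β i ^ 2 := by
  have hcard : (0 : ℝ) < Fintype.card ι := by exact_mod_cast Fintype.card_pos
  have amgm := Real.geom_mean_le_arith_mean Finset.univ (fun _ => (1 : ℝ)) (fun i => β i ^ 2)
    (fun _ _ => zero_le_one) (by simpa using hcard) (fun i _ => sq_nonneg (β i))
  simp only [Real.rpow_one, one_mul, Finset.sum_const, Finset.card_univ, nsmul_eq_mul, mul_one,
    Finset.prod_pow] at amgm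
  rwa [le_div_iff₀ hcard, ← Real.rpow_natCast,
    ← Real.rpow_mul (Finset.prod_nonneg fun i _ => hβ i), mul_comm, Nat.cast_ofNat,
    ← div_eq_mul_inv] at amgm

theorem le_mul_prod_of_succ_le {n : ℕ} (g : Fin (n + 1) → ℝ) {β : Fin n → ℝ} (hβ : ∀ l, 0 ≤ β l)
    (h : ∀ l : Fin n, g l.succ ≤ g l.castSucc * β l) : g (Fin.last n) ≤ g 0 * ∏ l, β l := by
  induction n with
  | zero => simp
  | succ n ih =>
    rw [Fin.prod_univ_castSucc, ← mul_assoc]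
    exact (h (Fin.last n)).trans (mul_le_mul_of_nonneg_right
      (ih (fun l => g l.castSucc) (fun l => hβ _) (fun l => h l.castSucc)) (hβ _))

variable {𝕜 κ ρ : Type*} [RCLike 𝕜] {n : ℕ} {ι : Fin (n + 1) → Type*} [∀ l, Fintype (ι l)]
  [∀ l, DecidableEq (ι l)] [Fintype κ] [LinearOrder ρ]

namespace MatrixChain

section Gain

variable [LocallyFiniteOrderBot ρ] [WellFoundedLT ρ]

/-- The factor by which each matrix of a chain stretches the `i`-th normalized Gram–Schmidt vector
of the family that reaches it when the chain is applied to the family `f`. -/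
def gain (M : MatrixChain 𝕜 ι κ) (f : ρ → EuclideanSpace 𝕜 (ι 0)) (i : ρ) : Fin (n + 1) → ℝ :=
  Fin.snoc (α := fun _ => ℝ)
    (fun l => ‖toEuclideanLin (M.layer l)
      (gramSchmidtNormed 𝕜 (fun j => toEuclideanLin (M.partialProd l.castSucc) (f j)) i)‖)
    ‖toEuclideanLin M.final
      (gramSchmidtNormed 𝕜 (fun j => toEuclideanLin (M.partialProd (Fin.last n)) (f j)) i)‖

theorem gain_castSucc (M : MatrixChain 𝕜 ι κ) (f : ρ → EuclideanSpace 𝕜 (ι 0)) (i : ρ)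
    (l : Fin n) : M.gain f i l.castSucc = ‖toEuclideanLin (M.layer l)
      (gramSchmidtNormed 𝕜 (fun j => toEuclideanLin (M.partialProd l.castSucc) (f j)) i)‖ :=
  Fin.snoc_castSucc (α := fun _ => ℝ) _ _ l

theorem gain_last (M : MatrixChain 𝕜 ι κ) (f : ρ → EuclideanSpace 𝕜 (ι 0)) (i : ρ) :
    M.gain f i (Fin.last n) = ‖toEuclideanLin M.final
      (gramSchmidtNormed 𝕜 (fun j => toEuclideanLin (M.partialProd (Fin.last n)) (f j)) i)‖ :=
  Fin.snoc_last (α := fun _ => ℝ) _ _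

theorem gain_nonneg (M : MatrixChain 𝕜 ι κ) (f : ρ → EuclideanSpace 𝕜 (ι 0)) (i : ρ)
    (l : Fin (n + 1)) : 0 ≤ M.gain f i l := by
  cases l using Fin.lastCases with
  | last => exact (gain_last M f i).symm ▸ norm_nonneg _
  | cast l => exact (gain_castSucc M f i l).symm ▸ norm_nonneg _

theorem norm_gramSchmidt_prod_le (M : MatrixChain 𝕜 ι κ) (f : ρ → EuclideanSpace 𝕜 (ι 0))
    (i : ρ) : ‖gramSchmidt 𝕜 (fun j => toEuclideanLin M.prod (f j)) i‖
      ≤ ‖gramSchmidt 𝕜 f i‖ * ∏ l, M.gain f i l := by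
  set z : ∀ l, ρ → EuclideanSpace 𝕜 (ι l) := fun l j => toEuclideanLin (M.partialProd l) (f j)
  have hz : z 0 = f := by
    funext j
    simp [z, partialProd_zero]
  have hz_succ (l : Fin n) : z l.succ = fun j => toEuclideanLin (M.layer l) (z l.castSucc j) := by
    funext j
    simp [z, partialProd_succ]
  have hz_prod : (fun j => toEuclideanLin M.prod (f j))
      = fun j => toEuclideanLin M.final (z (Fin.last n) j) := by
    funext j
    simp [z, prod]
  have layers := le_mul_prod_of_succ_le (fun l => ‖gramSchmidt 𝕜 (z l) i‖)
    (fun l => M.gain_nonneg f i l.castSucc) fun l => by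
      rw [hz_succ, gain_castSucc]
      exact norm_gramSchmidt_map_le_mul _ _ _
  rw [hz] at layers
  rw [hz_prod, Fin.prod_univ_castSucc, ← mul_assoc, gain_last]
  exact (norm_gramSchmidt_map_le_mul _ _ _).trans
    (mul_le_mul_of_nonneg_right layers (norm_nonneg _))

end Gain

variable [Fintype ρ] [LocallyFiniteOrderBot ρ]

open scoped Matrix.Norms.Frobenius in
theorem sum_sum_gain_sq_le (M : MatrixChain 𝕜 ι κ) (f : ρ → EuclideanSpace 𝕜 (ι 0)) :
    ∑ i, ∑ l, M.gain f i l ^ 2 ≤ M.sqNormSum := by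
  rw [Finset.sum_comm, Fin.sum_univ_castSucc, sqNormSum]
  simp only [gain_castSucc, gain_last]
  exact add_le_add
    (Finset.sum_le_sum fun l _ => sum_norm_toEuclideanLin_gramSchmidtNormed_le _ _)
    (sum_norm_toEuclideanLin_gramSchmidtNormed_le _ _)

end MatrixChain

variable [Fintype ρ] [LocallyFiniteOrderBot ρ]

-- The right singular vectors start as an orthonormal family and arrive as an orthogonal family of
-- lengths `s i`, so `s i` is at most the product of the gains; AM–GM then bounds their squares.
theorem IsThinSVD.mul_sum_rpow_le_sqNormSum {M : MatrixChain 𝕜 ι κ} {U : Matrix κ ρ 𝕜} {s : ρ → ℝ}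
    {V : Matrix (ι 0) ρ 𝕜} (h : IsThinSVD M.prod U s V) :
    ((n + 1 : ℕ) : ℝ) * ∑ i, s i ^ (2 / ((n + 1 : ℕ) : ℝ)) ≤ M.sqNormSum := by
  have map_colVec (i : ρ) : toEuclideanLin M.prod (colVec V i) = (s i : 𝕜) • colVec U i := by
    rw [toEuclideanLin_colVec, h.mul_right_eq, colVec_mul_diagonal]
  have hU : Orthonormal 𝕜 (colVec U) := orthonormal_colVec_iff.2 h.left
  have hV : Orthonormal 𝕜 (colVec V) := orthonormal_colVec_iff.2 h.right
  have le_prod_gain (i : ρ) : s i ≤ ∏ l, M.gain (colVec V) i l := by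
    have := M.norm_gramSchmidt_prod_le (colVec V) i
    rw [gramSchmidt_of_orthogonal 𝕜 hV.2, hV.1, one_mul] at this
    simp only [map_colVec] at this
    rwa [gramSchmidt_of_orthogonal, norm_smul, hU.1, mul_one, RCLike.norm_ofReal,
      abs_of_nonneg (h.nonneg i)] at this
    intro i j hij
    simp only [inner_smul_left, inner_smul_right, hU.2 hij, mul_zero]
  rw [Finset.mul_sum]
  refine (Finset.sum_le_sum fun i _ => ?_).trans (M.sum_sum_gain_sq_le (colVec V))
  refine le_trans ?_ (by
    simpa only [Fintype.card_fin] using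
      card_mul_prod_rpow_le_sum_sq (M.gain_nonneg (colVec V) i))
  gcongr
  · exact h.nonneg i
  · exact le_prod_gain i

end LowerBound

section UpperBound

theorem conjTranspose_submatrix_one_mul_self {𝕜 m ρ : Type*} [RCLike 𝕜] [Fintype m] [DecidableEq m]
    [DecidableEq ρ] (e : ρ ↪ m) :
    ((1 : Matrix m m 𝕜).submatrix id e)ᴴ * (1 : Matrix m m 𝕜).submatrix id e = 1 := by
  rw [conjTranspose_submatrix, conjTranspose_one, ← submatrix_mul _ _ e id e Function.bijective_id,
    Matrix.one_mul, submatrix_one _ e.injective]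

variable {𝕜 κ ρ : Type*} [RCLike 𝕜] {n : ℕ} {ι : Fin (n + 1) → Type*} [Fintype ρ] [DecidableEq ρ]

namespace MatrixChain

/-- The chain that acts diagonally, with entries `t`, between the orthonormal families given by
the columns of `Q 0, …, Q n, U`. -/
def ofDiagonal (Q : ∀ l, Matrix (ι l) ρ 𝕜) (U : Matrix κ ρ 𝕜) (t : ρ → ℝ) :
    MatrixChain 𝕜 ι κ where
  layer l := Q l.succ * diagonal (fun i => (t i : 𝕜)) * (Q l.castSucc)ᴴ
  final := U * diagonal (fun i => (t i : 𝕜)) * (Q (Fin.last n))ᴴ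

variable {Q : ∀ l, Matrix (ι l) ρ 𝕜} [∀ l, Fintype (ι l)]

theorem conjTranspose_mul_partialProd_ofDiagonal [DecidableEq (ι 0)] (hQ : ∀ l, (Q l)ᴴ * Q l = 1)
    (U : Matrix κ ρ 𝕜) (t : ρ → ℝ) (l : Fin (n + 1)) :
    (Q l)ᴴ * (ofDiagonal Q U t).partialProd l
      = diagonal (fun i => (t i : 𝕜)) ^ (l : ℕ) * (Q 0)ᴴ := by
  induction l using Fin.induction with
  | zero => rw [partialProd_zero, Fin.val_zero, pow_zero, Matrix.mul_one, Matrix.one_mul]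
  | succ l ih =>
    simp only [partialProd_succ, ofDiagonal, ← Matrix.mul_assoc, hQ, Matrix.one_mul]
    rw [Matrix.mul_assoc, ← ofDiagonal, ih, Fin.val_castSucc, Fin.val_succ, pow_succ',
      Matrix.mul_assoc]

theorem prod_ofDiagonal [DecidableEq (ι 0)] (hQ : ∀ l, (Q l)ᴴ * Q l = 1) (U : Matrix κ ρ 𝕜)
    (t : ρ → ℝ) : (ofDiagonal Q U t).prod
      = U * diagonal (fun i => ((t i ^ (n + 1) : ℝ) : 𝕜)) * (Q 0)ᴴ := by
  have hpow : diagonal (fun i => (t i : 𝕜)) * diagonal (fun i => (t i : 𝕜)) ^ n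
      = diagonal fun i => ((t i ^ (n + 1) : ℝ) : 𝕜) := by
    rw [← pow_succ', diagonal_pow]
    congr 1
    ext i
    simp
  calc (ofDiagonal Q U t).prod
      = U * diagonal (fun i => (t i : 𝕜)) *
          ((Q (Fin.last n))ᴴ * (ofDiagonal Q U t).partialProd (Fin.last n)) :=
        Matrix.mul_assoc _ _ _
    _ = _ := by
        rw [conjTranspose_mul_partialProd_ofDiagonal hQ, Fin.val_last, ← Matrix.mul_assoc,
          Matrix.mul_assoc U, hpow]

theorem sqNormSum_ofDiagonal [Fintype κ] (hQ : ∀ l, (Q l)ᴴ * Q l = 1) {U : Matrix κ ρ 𝕜}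
    (hU : Uᴴ * U = 1) (t : ρ → ℝ) :
    (ofDiagonal Q U t).sqNormSum = ((n + 1 : ℕ) : ℝ) * ∑ i, t i ^ 2 := by
  simp only [sqNormSum, ofDiagonal, frobenius_norm_sq_mul_diagonal_mul hU (hQ _),
    frobenius_norm_sq_mul_diagonal_mul (hQ _) (hQ _), Finset.sum_const, Finset.card_univ,
    Fintype.card_fin, nsmul_eq_mul]
  push_cast
  ring

end MatrixChain

-- The optimal chain distributes `diag(s)` evenly, as `diag(s ^ (1 / L))`, over its `L` matrices.
theorem IsThinSVD.exists_matrixChain [∀ l, Fintype (ι l)] [∀ l, DecidableEq (ι l)] [Fintype κ]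
    {A : Matrix κ (ι 0) 𝕜} {U : Matrix κ ρ 𝕜} {s : ρ → ℝ} {V : Matrix (ι 0) ρ 𝕜}
    (h : IsThinSVD A U s V) (e : ∀ l : Fin n, ρ ↪ ι l.succ) :
    ∃ M : MatrixChain 𝕜 ι κ, M.prod = A ∧
      M.sqNormSum = ((n + 1 : ℕ) : ℝ) * ∑ i, s i ^ (2 / ((n + 1 : ℕ) : ℝ)) := by
  let Q : ∀ l, Matrix (ι l) ρ 𝕜 := Fin.cases V fun l => (1 : Matrix _ _ 𝕜).submatrix id (e l)
  have hQ (l) : (Q l)ᴴ * Q l = 1 := by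
    cases l using Fin.cases with
    | zero => exact h.right
    | succ l => exact conjTranspose_submatrix_one_mul_self (e l)
  refine ⟨.ofDiagonal Q U fun i => s i ^ (1 / ((n + 1 : ℕ) : ℝ)), ?_, ?_⟩
  · have pow_root (i : ρ) : (s i ^ (1 / ((n + 1 : ℕ) : ℝ))) ^ (n + 1) = s i := by
      rw [one_div, Real.rpow_inv_natCast_pow (h.nonneg i) n.succ_ne_zero]
    simp only [MatrixChain.prod_ofDiagonal hQ, pow_root]
    exact h.eq.symm
  · rw [MatrixChain.sqNormSum_ofDiagonal hQ h.left]
    congr! 2 with i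
    rw [← Real.rpow_mul_natCast (h.nonneg i), one_div_mul_eq_div, Nat.cast_ofNat]

end UpperBound

section Schatten

variable {K n : ℕ} {C : Fin (n + 1) → ℕ}

theorem MatrixChain.mul_schatten_rpow_le_sqNormSum
    (M : MatrixChain ℂ (fun l => Fin (C l)) (Fin K)) :
    ((n + 1 : ℕ) : ℝ) * schatten (2 / ((n + 1 : ℕ) : ℝ)) M.prod ^ (2 / ((n + 1 : ℕ) : ℝ))
      ≤ M.sqNormSum := by
  obtain ⟨U, V, h⟩ := exists_isThinSVD M.prod le_rfl (rank_le_card_height _)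
    (rank_le_card_width _)
  rw [h.schatten_rpow (by positivity)]
  exact h.mul_sum_rpow_le_sqNormSum

theorem schatten_map_conj_rpow {a b : ℕ} {p : ℝ} (hp : 0 < p) (A : Matrix (Fin a) (Fin b) ℂ) :
    schatten p (A.map conj) ^ p = schatten p A ^ p := by
  obtain ⟨U, V, h⟩ := exists_isThinSVD A le_rfl (rank_le_card_height A) (rank_le_card_width A)
  rw [h.schatten_rpow hp,
    (h.map (starRingEnd ℂ) (fun _ => rfl) Complex.conj_ofReal).schatten_rpow hp]

theorem exists_eq_map_ofReal {m n : Type*} {A : Matrix m n ℂ} (hA : A.map conj = A) :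
    ∃ B : Matrix m n ℝ, A = B.map Complex.ofRealHom :=
  ⟨A.map Complex.re, by
    ext c d
    exact (Complex.conj_eq_iff_re.1 (congrFun (congrFun hA c) d)).symm⟩

theorem exists_matrixChain_of_rank_le {A : Matrix (Fin K) (Fin (C 0)) ℂ} (hA : ∀ l, A.rank ≤ C l) :
    ∃ M : MatrixChain ℂ (fun l => Fin (C l)) (Fin K), M.prod = A ∧
      M.sqNormSum = ((n + 1 : ℕ) : ℝ) *
        schatten (2 / ((n + 1 : ℕ) : ℝ)) A ^ (2 / ((n + 1 : ℕ) : ℝ)) ∧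
      (A.map conj = A → M.map (starRingEnd ℂ) = M) := by
  have hp : (0 : ℝ) < 2 / ((n + 1 : ℕ) : ℝ) := by positivity
  by_cases hreal : A.map conj = A
  · obtain ⟨B, rfl⟩ := exists_eq_map_ofReal hreal
    rw [rank_map_eq B Complex.ofRealHom (fun x => (Complex.conj_ofReal x).symm) fun _ => rfl] at hA
    obtain ⟨U, V, h⟩ := exists_isThinSVD B le_rfl (rank_le_card_height B) (rank_le_card_width B)
    obtain ⟨M, hM, hnorm⟩ := h.exists_matrixChain (ι := fun l => Fin (C l))
      fun l => Fin.castLEEmb (hA l.succ)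
    refine ⟨M.map Complex.ofRealHom, ?_, ?_, fun _ => ?_⟩
    · rw [MatrixChain.map_prod, hM]
    · rw [MatrixChain.sqNormSum_map Complex.norm_real, hnorm,
        (h.map Complex.ofRealHom (fun x => (Complex.conj_ofReal x).symm) fun _ => rfl).schatten_rpow
          hp]
    · have hconj : ⇑(starRingEnd ℂ) ∘ ⇑Complex.ofRealHom = ⇑Complex.ofRealHom :=
        funext Complex.conj_ofReal
      simp only [MatrixChain.map, Matrix.map_map, hconj]
  · obtain ⟨U, V, h⟩ := exists_isThinSVD A le_rfl (rank_le_card_height A) (rank_le_card_width A)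
    obtain ⟨M, hM, hnorm⟩ := h.exists_matrixChain (ι := fun l => Fin (C l))
      fun l => Fin.castLEEmb (hA l.succ)
    exact ⟨M, hM, by rw [hnorm, h.schatten_rpow hp], fun h => absurd h hreal⟩

end Schatten

section Fourier

section Char

variable {R S M : Type*} [CommRing R] [CommRing S] [CommMonoid M]

/-- The character `(p, q) ↦ ψ p * χ q` of a product of rings, through which the two-dimensional
Fourier transform becomes a transform over a single ring. -/
def prodChar (ψ : AddChar R M) (χ : AddChar S M) : AddChar (R × S) M :=
  ψ.compAddMonoidHom (AddMonoidHom.fst R S) * χ.compAddMonoidHom (AddMonoidHom.snd R S)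

theorem prodChar_apply (ψ : AddChar R M) (χ : AddChar S M) (p : R × S) :
    prodChar ψ χ p = ψ p.1 * χ p.2 := rfl

theorem isPrimitive_prodChar {ψ : AddChar R M} {χ : AddChar S M} (hψ : ψ.IsPrimitive)
    (hχ : χ.IsPrimitive) : (prodChar ψ χ).IsPrimitive := by
  rintro ⟨a, b⟩ hab h
  simp only [AddChar.eq_one_iff, AddChar.mulShift_apply, prodChar_apply, Prod.forall,
    Prod.mk_mul_mk] at h
  refine hab (Prod.ext (not_imp_not.1 (hψ (a := a)) ?_) (not_imp_not.1 (hχ (a := b)) ?_))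
  · exact AddChar.eq_one_iff.2 fun x => by simpa using h x 0
  · exact AddChar.eq_one_iff.2 fun y => by simpa using h 0 y

end Char

variable {R : Type*} [CommRing R] [Fintype R] {ψ : AddChar R ℂ}

/-- The unitary Fourier transform on a finite commutative ring, whose dual is identified with the
ring itself by means of the character `ψ`. -/
def fourier (ψ : AddChar R ℂ) (f : R → ℂ) (q : R) : ℂ :=
  (√(Fintype.card R : ℝ) : ℂ)⁻¹ * ∑ p, f p * ψ (-(p * q))

theorem sqrt_card_ne_zero (R : Type*) [Fintype R] [Nonempty R] : √(Fintype.card R : ℝ) ≠ 0 :=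
  (Real.sqrt_pos.2 (Nat.cast_pos.2 Fintype.card_pos)).ne'

theorem fourier_comp_neg (ψ : AddChar R ℂ) (f : R → ℂ) (q : R) :
    fourier ψ (fun p => f (-p)) q = fourier ψ f (-q) := by
  simp only [fourier]
  rw [← Equiv.sum_comp (Equiv.neg R)]
  simp

theorem conj_fourier (ψ : AddChar R ℂ) (f : R → ℂ) (q : R) :
    conj (fourier ψ f q) = fourier ψ (fun p => conj (f p)) (-q) := by
  simp [fourier, ← AddChar.map_neg_eq_conj]

theorem sum_fourier_mul (ψ : AddChar R ℂ) (f g : R → ℂ) :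
    ∑ q, fourier ψ f q * g q = ∑ p, f p * fourier ψ g p := by
  simp only [fourier, Finset.mul_sum, Finset.sum_mul]
  rw [Finset.sum_comm]
  exact Finset.sum_congr rfl fun p _ => Finset.sum_congr rfl fun q _ => by
    rw [mul_comm p q]; ring

theorem fourier_fourier (hψ : ψ.IsPrimitive) (f : R → ℂ) (p : R) :
    fourier ψ (fourier ψ f) p = f (-p) := by
  classical
  have hcard : (√(Fintype.card R : ℝ) : ℂ) * √(Fintype.card R : ℝ) = Fintype.card R := by
    rw [← Complex.ofReal_mul, Real.mul_self_sqrt (Nat.cast_nonneg _), Complex.ofReal_natCast]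
  have hcard₀ : (Fintype.card R : ℂ) ≠ 0 := Nat.cast_ne_zero.2 Fintype.card_ne_zero
  have hψsum : ∀ p', ∑ q, ψ (-(p' * q)) * ψ (-(q * p))
      = if p' = -p then (Fintype.card R : ℂ) else 0 := fun p' => by
    simp_rw [← AddChar.map_add_eq_mul, show ∀ q, -(p' * q) + -(q * p) = q * (-p - p') by
      intro q; ring]
    rw [AddChar.sum_mulShift _ hψ]
    simp only [sub_eq_zero, eq_comm]
    norm_cast
  simp only [fourier, Finset.mul_sum, Finset.sum_mul]
  rw [Finset.sum_comm]
  calc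
    _ = ∑ p', (Fintype.card R : ℂ)⁻¹ * f p' * ∑ q, ψ (-(p' * q)) * ψ (-(q * p)) := by
      refine Finset.sum_congr rfl fun p' _ => ?_
      rw [Finset.mul_sum, ← hcard, mul_inv]
      exact Finset.sum_congr rfl fun q _ => by ring
    _ = f (-p) := by simp [hψsum, hcard₀, mul_right_comm]

theorem fourier_injective (hψ : ψ.IsPrimitive) : Function.Injective (fourier ψ) := fun f g h =>
  funext fun p => by rw [← neg_neg p, ← fourier_fourier hψ f, h, fourier_fourier hψ g]

theorem sum_norm_fourier_sq (hψ : ψ.IsPrimitive) (f : R → ℂ) :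
    ∑ q, ‖fourier ψ f q‖ ^ 2 = ∑ p, ‖f p‖ ^ 2 := by
  have hconj : ∀ p, fourier ψ (fun q => conj (fourier ψ f q)) p = conj (f p) := fun p => by
    rw [← neg_neg p, ← conj_fourier, fourier_fourier hψ, neg_neg]
  have h := sum_fourier_mul ψ f fun q => conj (fourier ψ f q)
  simp only [hconj, Complex.mul_conj'] at h
  exact_mod_cast h

theorem exists_fourier_ofReal_eq_iff (hψ : ψ.IsPrimitive) {g : R → ℂ} :
    (∃ f : R → ℝ, fourier ψ (fun p => (f p : ℂ)) = g) ↔ ∀ q, g (-q) = conj (g q) := by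
  constructor
  · rintro ⟨f, rfl⟩ q
    simp only [conj_fourier, Complex.conj_ofReal]
  · intro hg
    have hreal : ∀ p, ((fourier ψ g (-p)).re : ℂ) = fourier ψ g (-p) := fun p => by
      rw [← Complex.conj_eq_iff_re, conj_fourier, ← fourier_comp_neg ψ g]
      simp only [hg, neg_neg]
    refine ⟨fun p => (fourier ψ g (-p)).re, funext fun q => ?_⟩
    simp only [hreal, fourier_comp_neg, fourier_fourier hψ, neg_neg]

theorem fourier_convolution (ψ : AddChar R ℂ) (f g : R → ℂ) (q : R) :
    fourier ψ (fun p => ∑ p', f p' * g (p - p')) q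
      = (√(Fintype.card R : ℝ) : ℂ) * (fourier ψ f q * fourier ψ g q) := by
  have h : (√(Fintype.card R : ℝ) : ℂ) ≠ 0 := Complex.ofReal_ne_zero.2 (sqrt_card_ne_zero R)
  have hshift : ∀ p, ∑ p', f p * g (p' - p) * ψ (-(p' * q))
      = f p * ψ (-(p * q)) * ∑ p', g p' * ψ (-(p' * q)) := fun p => by
    rw [← Equiv.sum_comp (Equiv.addRight p), Finset.mul_sum]
    refine Finset.sum_congr rfl fun p' _ => ?_
    rw [Equiv.coe_addRight, add_sub_cancel_right, add_mul, neg_add, AddChar.map_add_eq_mul]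
    ring
  simp only [fourier, Finset.sum_mul]
  rw [Finset.sum_comm]
  simp only [hshift, ← Finset.sum_mul]
  field_simp

end Fourier

section Tensors

variable {H W a b : ℕ}

/-- The character of `ℤ/H × ℤ/W` for which `fourier` is the two-dimensional discrete Fourier
transform. -/
def spatialChar (H W : ℕ) [NeZero H] [NeZero W] : AddChar (ZMod H × ZMod W) ℂ :=
  prodChar ZMod.stdAddChar ZMod.stdAddChar

section Reflect

variable {R : Type}

/-- The reflection of a tensor in its spatial indices, which turns the contraction of two Fourier
transforms into the contraction of the original tensors. -/
def reflect (w : Tensor R a H W b) : Tensor R a H W b :=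
  fun c i j d => w c (-i) (-j) d

theorem reflect_involutive :
    Function.Involutive (reflect : Tensor R a H W b → Tensor R a H W b) := fun w => by
  funext c i j d
  simp only [reflect, neg_neg]

end Reflect

theorem pointwise_smul {R : Type} [CommSemiring R] (t : R) (w : Tensor R a H W b)
    (x : Image R b H W) : pointwise w (t • x) = t • pointwise w x := by
  funext c i j
  simp only [pointwise, Pi.smul_apply, smul_eq_mul, Finset.mul_sum, mul_left_comm]

variable [NeZero H] [NeZero W]

theorem isPrimitive_spatialChar : (spatialChar H W).IsPrimitive :=
  isPrimitive_prodChar (ZMod.isPrimitive_stdAddChar H) (ZMod.isPrimitive_stdAddChar W)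

theorem sqrt_card_spatial : √(Fintype.card (ZMod H × ZMod W) : ℝ) = √((H : ℝ) * W) := by
  rw [Fintype.card_prod, ZMod.card, ZMod.card, Nat.cast_mul]

theorem sum_sum_mul_dftKernel (f : ZMod H × ZMod W → ℂ) (i : ZMod H) (j : ZMod W) :
    ∑ m, ∑ n, f (m, n) * dftKernel m i n j = fourier (spatialChar H W) f (i, j) := by
  simp only [fourier, sqrt_card_spatial, Finset.mul_sum, Fintype.sum_prod_type, dftKernel,
    spatialChar, prodChar_apply, one_div, Complex.ofReal_inv]
  exact Finset.sum_congr rfl fun m _ => Finset.sum_congr rfl fun n _ => mul_left_comm ..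

theorem dftImage_apply (x : Image ℝ a H W) (c : Fin a) (i : ZMod H) (j : ZMod W) :
    dftImage x c i j = fourier (spatialChar H W) (fun p => (x c p.1 p.2 : ℂ)) (i, j) :=
  sum_sum_mul_dftKernel (fun p => (x c p.1 p.2 : ℂ)) i j

theorem dftTensor_apply (w : Tensor ℝ a H W b) (c : Fin a) (i : ZMod H) (j : ZMod W)
    (d : Fin b) :
    dftTensor w c i j d = fourier (spatialChar H W) (fun p => (w c p.1 p.2 d : ℂ)) (i, j) :=
  sum_sum_mul_dftKernel (fun p => (w c p.1 p.2 d : ℂ)) i j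

theorem exists_eq_dftTensor_iff {v : Tensor ℂ a H W b} :
    (∃ u : Tensor ℝ a H W b, v = dftTensor u) ↔
      ∀ i j, block v (-i) (-j) = (block v i j).map conj := by
  constructor
  · rintro ⟨u, rfl⟩ i j
    ext c d
    simp only [block, Matrix.of_apply, Matrix.map_apply, dftTensor_apply]
    exact (exists_fourier_ofReal_eq_iff isPrimitive_spatialChar).1
      ⟨fun p => u c p.1 p.2 d, rfl⟩ (i, j)
  · intro h
    choose u hu using fun c d =>
      (exists_fourier_ofReal_eq_iff (isPrimitive_spatialChar (H := H) (W := W))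
        (g := fun q => v c q.1 q.2 d)).2 fun q => congrFun (congrFun (h q.1 q.2) c) d
    refine ⟨fun c i j d => u c d (i, j), ?_⟩
    funext c i j d
    rw [dftTensor_apply, hu]

section Norm

theorem sqNorm_eq_sum_prod {R : Type} [Norm R] (w : Tensor R a H W b) :
    sqNorm w = ∑ c, ∑ d, ∑ p : ZMod H × ZMod W, ‖w c p.1 p.2 d‖ ^ 2 := by
  simp only [sqNorm, Fintype.sum_prod_type]
  exact Finset.sum_congr rfl fun c _ =>
    (Finset.sum_congr rfl fun _ _ => Finset.sum_comm).trans Finset.sum_comm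

theorem sqNorm_dftTensor (w : Tensor ℝ a H W b) : sqNorm (dftTensor w) = sqNorm w := by
  simp only [sqNorm_eq_sum_prod, dftTensor_apply, Prod.mk.eta,
    sum_norm_fourier_sq isPrimitive_spatialChar, Complex.norm_real]

theorem sqNorm_reflect {R : Type} [Norm R] (w : Tensor R a H W b) :
    sqNorm (reflect w) = sqNorm w := by
  simp only [sqNorm_eq_sum_prod, reflect]
  exact Finset.sum_congr rfl fun c _ => Finset.sum_congr rfl fun d _ =>
    Equiv.sum_comp (Equiv.neg (ZMod H × ZMod W)) fun p => ‖w c p.1 p.2 d‖ ^ 2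

theorem sqNorm_smul {R : Type} [NormedRing R] [NormMulClass R] (t : R) (w : Tensor R a H W b) :
    sqNorm (t • w) = ‖t‖ ^ 2 * sqNorm w := by
  simp only [sqNorm, Pi.smul_apply, smul_eq_mul, norm_mul, mul_pow, Finset.mul_sum]

open scoped Matrix.Norms.Frobenius in
theorem sqNorm_eq_sum_norm_block {R : Type} [SeminormedAddCommGroup R] (w : Tensor R a H W b) :
    sqNorm w = ∑ i, ∑ j, ‖block w i j‖ ^ 2 := by
  simp only [sqNorm, frobenius_norm_sq, block, Matrix.of_apply]
  exact Finset.sum_comm.trans (Finset.sum_congr rfl fun i _ => Finset.sum_comm)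

end Norm

section Bilinear

variable {R : Type} [CommSemiring R]

theorem conv_smul_smul (s t : R) (w : Tensor R a H W b) (x : Image R b H W) :
    conv (s • w) (t • x) = (s * t) • conv w x := by
  funext c i j
  simp only [conv, Pi.smul_apply, smul_eq_mul, Finset.mul_sum, mul_mul_mul_comm]

theorem contract_smul_smul (s t : R) (w : Tensor R a H W b) (x : Image R b H W) :
    contract (s • w) (t • x) = (s * t) • contract w x := by
  funext c
  simp only [contract, Pi.smul_apply, smul_eq_mul, Finset.mul_sum, mul_mul_mul_comm]

theorem contract_apply_eq_sum_prod (w : Tensor R a H W b) (x : Image R b H W) (c : Fin a) :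
    contract w x c = ∑ d, ∑ p : ZMod H × ZMod W, w c p.1 p.2 d * x d p.1 p.2 := by
  simp only [contract, Fintype.sum_prod_type]
  exact (Finset.sum_congr rfl fun _ _ => Finset.sum_comm).trans Finset.sum_comm

theorem conv_apply_eq_sum_prod (w : Tensor R a H W b) (x : Image R b H W) (c : Fin a)
    (p : ZMod H × ZMod W) :
    conv w x c p.1 p.2
      = ∑ d, ∑ p' : ZMod H × ZMod W, w c p'.1 p'.2 d * x d (p - p').1 (p - p').2 := by
  simp only [conv, Fintype.sum_prod_type]
  exact (Finset.sum_congr rfl fun _ _ => Finset.sum_comm).trans Finset.sum_comm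

end Bilinear

theorem dftImage_conv (w : Tensor ℝ a H W b) (x : Image ℝ b H W) :
    dftImage (conv w x) = (√((H : ℝ) * W) : ℂ) • pointwise (dftTensor w) (dftImage x) := by
  funext c i j
  simp only [Pi.smul_apply, smul_eq_mul, pointwise, Finset.mul_sum, dftTensor_apply,
    dftImage_apply, ← sqrt_card_spatial, ← fourier_convolution]
  simp only [fourier, conv_apply_eq_sum_prod, Complex.ofReal_sum, Complex.ofReal_mul,
    Finset.sum_mul]
  rw [← Finset.mul_sum, Finset.sum_comm]

theorem contract_dftImage (v : Tensor ℂ a H W b) (x : Image ℝ b H W) (c : Fin a) :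
    contract v (dftImage x) c
      = ∑ d, ∑ p, fourier (spatialChar H W) (fun q => v c q.1 q.2 d) p * x d p.1 p.2 := by
  simp only [contract_apply_eq_sum_prod, dftImage_apply, Prod.mk.eta, sum_fourier_mul]

theorem contract_dftTensor_dftImage (w : Tensor ℝ a H W b) (x : Image ℝ b H W) (c : Fin a) :
    contract (dftTensor w) (dftImage x) c = (contract (reflect w) x c : ℝ) := by
  rw [contract_dftImage, contract_apply_eq_sum_prod]
  simp only [dftTensor_apply, Prod.mk.eta]
  push_cast [fourier_fourier isPrimitive_spatialChar]
  rfl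

theorem contract_dftImage_eq_iff {v v' : Tensor ℂ a H W b} :
    (∀ x : Image ℝ b H W, contract v (dftImage x) = contract v' (dftImage x)) ↔ v = v' := by
  refine ⟨fun h => ?_, fun h x => by rw [h]⟩
  have hsingle : ∀ (v : Tensor ℂ a H W b) c d (p : ZMod H × ZMod W),
      contract v (dftImage fun d' i j => if d' = d then if (i, j) = p then 1 else 0 else 0) c
        = fourier (spatialChar H W) (fun q => v c q.1 q.2 d) p := fun v c d p => by
    simp [contract_dftImage, apply_ite ((↑) : ℝ → ℂ)]
  funext c i j d
  refine congrFun (fourier_injective isPrimitive_spatialChar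
    (a₁ := fun q => v c q.1 q.2 d) (a₂ := fun q => v' c q.1 q.2 d) (funext fun p => ?_)) (i, j)
  rw [← hsingle, h, hsingle]

end Tensors

section Minimization

theorem EquivalentMinimization.of_isLeast {α β : Type} {J : α → ℝ} {S : Set β} {J' : β → ℝ}
    {Rep : α → β → Prop} (h : ∀ a, ∃! b, b ∈ S ∧ Rep a b)
    (hmin : ∀ b ∈ S, IsLeast (J '' {a | Rep a b}) (J' b)) :
    EquivalentMinimization J S J' Rep := by
  have hle : ∀ a, ∃ b ∈ S, J' b ≤ J a := fun a =>
    let ⟨b, ⟨hb, hab⟩, _⟩ := h a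
    ⟨b, hb, (hmin b hb).2 ⟨a, hab, rfl⟩⟩
  have hex : ∀ b ∈ S, ∃ a, Rep a b ∧ J a = J' b := fun b hb => (hmin b hb).1
  have hsub : J' '' S ⊆ Set.range J := by
    rintro _ ⟨b, hb, rfl⟩
    obtain ⟨a, -, ha⟩ := hex b hb
    exact ⟨a, ha⟩
  have hlower : lowerBounds (J' '' S) ⊆ lowerBounds (Set.range J) := by
    rintro m hm _ ⟨a, rfl⟩
    obtain ⟨b, hb, hab⟩ := hle a
    exact (hm ⟨b, hb, rfl⟩).trans hab
  refine ⟨h, hmin, le_antisymm ?_ ?_, fun m => ⟨fun hm => ⟨?_, ?_⟩, fun hm => ⟨?_, ?_⟩⟩, ?_, ?_⟩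
  · refine le_iInf₂ fun b hb => ?_
    obtain ⟨a, -, ha⟩ := hex b hb
    exact (iInf_le _ a).trans_eq (congrArg _ ha)
  · refine le_iInf fun a => ?_
    obtain ⟨b, hb, hab⟩ := hle a
    exact (iInf₂_le b hb).trans (EReal.coe_le_coe hab)
  · obtain ⟨a, rfl⟩ := hm.1
    obtain ⟨b, hb, hab⟩ := hle a
    exact ⟨b, hb, hab.antisymm (hm.2 (hsub ⟨b, hb, rfl⟩))⟩
  · exact lowerBounds_mono_set hsub hm.2
  · exact hsub hm.1
  · exact hlower hm.2
  · intro a ha b hb hab b' hb'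
    obtain ⟨a', -, ha'⟩ := hex b' hb'
    exact ((hmin b hb).2 ⟨a, hab, rfl⟩).trans ((ha (Set.mem_univ a')).trans_eq ha')
  · intro b hb hbmin
    obtain ⟨a, hab, ha⟩ := hex b hb
    refine ⟨a, hab, fun a' _ => ?_⟩
    obtain ⟨b', hb', hab'⟩ := hle a'
    exact ha.trans_le ((hbmin hb').trans hab')

theorem EquivalentMinimization.comp {α α' β : Type} {J : α → ℝ} {S : Set β} {J' : β → ℝ}
    {Rep : α → β → Prop} (h : EquivalentMinimization J S J' Rep) {φ : α' → α}
    (hφ : Function.Surjective φ) :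
    EquivalentMinimization (fun a => J (φ a)) S J' (fun a => Rep (φ a)) := by
  refine .of_isLeast (fun a => h.existsUnique (φ a)) fun b hb => ?_
  have himage : (fun a => J (φ a)) '' {a | Rep (φ a) b} = J '' {a | Rep a b} := by
    rw [← Function.comp_def, Set.image_comp, ← Set.image_preimage_eq {a | Rep a b} hφ]
    rfl
  exact himage ▸ h.isLeast_fiber b hb

-- Of each pair `a`, `σ a`, the smaller element in some linear order decides the choice.
theorem exists_equivariant_choice {α β : Type*} {σ : α → α} {τ : β → β}
    (hσ : Function.Involutive σ) (hτ : Function.Involutive τ) {P : α → β → Prop}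
    (hP : ∀ a b, P a b → P (σ a) (τ b)) (hex : ∀ a, ∃ b, P a b ∧ (σ a = a → τ b = b)) :
    ∃ f : α → β, ∀ a, P a (f a) ∧ f (σ a) = τ (f a) := by
  classical
  let : LinearOrder α := linearOrderOfSTO WellOrderingRel
  choose g hg hfix using hex
  refine ⟨fun a => if a ≤ σ a then g a else τ (g (σ a)), fun a => ⟨?_, ?_⟩⟩
  · dsimp only
    split_ifs
    · exact hg a
    · simpa only [hσ a] using hP _ _ (hg (σ a))
  · simp only [hσ a]
    rcases lt_trichotomy a (σ a) with h | h | h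
    · rw [if_neg h.not_ge, if_pos h.le]
    · rw [if_pos h.ge, if_pos h.le, ← h, hfix a h.symm]
    · rw [if_pos h.le, if_neg h.not_ge, hτ]

end Minimization

section Network

namespace Weights

section Blocks

variable {R : Type} {n K H W : ℕ} {C : Fin (n + 1) → ℕ}

/-- The linear network that a convolutional network induces at the frequency `(i, j)`. -/
def blocks (w : Weights R C K H W) (i : ZMod H) (j : ZMod W) :
    MatrixChain R (fun l => Fin (C l)) (Fin K) where
  layer l := block (w.layer l) i j
  final := block w.final i j

/-- The tensor `v` for which the frequency space network is `x ↦ vᵀ x`. -/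
def endToEnd [CommSemiring R] (w : Weights R C K H W) : Tensor R K H W (C 0) :=
  fun c i j d => (w.blocks i j).prod c d

theorem block_endToEnd [CommSemiring R] (w : Weights R C K H W) (i : ZMod H) (j : ZMod W) :
    block w.endToEnd i j = (w.blocks i j).prod := rfl

theorem rank_block_endToEnd_le [Field R] (w : Weights R C K H W) (i : ZMod H) (j : ZMod W) :
    (block w.endToEnd i j).rank ≤ min (⨅ l, C l) K := by
  rw [block_endToEnd]
  refine le_min (le_ciInf fun l => ?_) ((rank_le_card_height _).trans_eq (Fintype.card_fin K))
  exact ((w.blocks i j).rank_prod_le l).trans_eq (Fintype.card_fin (C l))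

/-- The output of the first `l` layers of the frequency space network. -/
def freqHidden [CommSemiring R] (w : Weights R C K H W) (x : Image R (C 0) H W)
    (l : Fin (n + 1)) : Image R (C l) H W :=
  Fin.induction (motive := fun l => Image R (C l) H W) x (fun l z => pointwise (w.layer l) z) l

theorem freqHidden_eq_mulVec [CommSemiring R] (w : Weights R C K H W) (x : Image R (C 0) H W)
    (l : Fin (n + 1)) (i : ZMod H) (j : ZMod W) :
    (fun c => w.freqHidden x l c i j) = (w.blocks i j).partialProd l *ᵥ fun d => x d i j := by
  induction l using Fin.induction with
  | zero => rw [MatrixChain.partialProd_zero, Matrix.one_mulVec]; rfl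
  | succ l ih => rw [MatrixChain.partialProd_succ, ← Matrix.mulVec_mulVec, ← ih]; rfl

/-- The output of the first `l` layers of the convolutional network. -/
def hidden [NeZero H] [NeZero W] [CommSemiring R] (w : Weights R C K H W)
    (x : Image R (C 0) H W) (l : Fin (n + 1)) : Image R (C l) H W :=
  Fin.induction (motive := fun l => Image R (C l) H W) x (fun l z => conv (w.layer l) z) l

theorem hidden_succ [NeZero H] [NeZero W] [CommSemiring R] (w : Weights R C K H W)
    (x : Image R (C 0) H W) (l : Fin n) :
    w.hidden x l.succ = conv (w.layer l) (w.hidden x l.castSucc) := rfl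

/-- The weights in which every layer is multiplied by `t`. -/
def scale [CommSemiring R] (t : R) (w : Weights R C K H W) : Weights R C K H W where
  layer l := t • w.layer l
  final := t • w.final

/-- The weights in which the last layer is reflected. -/
def reflectFinal (w : Weights R C K H W) : Weights R C K H W where
  layer := w.layer
  final := reflect w.final

theorem scale_surjective {R : Type} [Field R] {t : R} (ht : t ≠ 0) :
    Function.Surjective (scale (C := C) (K := K) (H := H) (W := W) t) := fun w =>
  ⟨w.scale t⁻¹, by simp only [scale, smul_inv_smul₀ ht]⟩

theorem reflectFinal_involutive :
    Function.Involutive (reflectFinal : Weights R C K H W → Weights R C K H W) := fun w => by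
  simp only [reflectFinal, reflect_involutive w.final]

variable [NeZero H] [NeZero W]

theorem sqNormSum_scale [NormedField R] (t : R) (w : Weights R C K H W) :
    (w.scale t).sqNormSum = ‖t‖ ^ 2 * w.sqNormSum := by
  simp only [sqNormSum, scale, sqNorm_smul, mul_add, Finset.mul_sum]

theorem sqNormSum_reflectFinal [Norm R] (w : Weights R C K H W) :
    w.reflectFinal.sqNormSum = w.sqNormSum := by
  simp only [sqNormSum, reflectFinal, sqNorm_reflect]

theorem hidden_scale [CommSemiring R] (t : R) (w : Weights R C K H W)
    (x : Image R (C 0) H W) (l : Fin (n + 1)) :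
    (w.scale t).hidden x l = t ^ (l : ℕ) • w.hidden x l := by
  induction l using Fin.induction with
  | zero => rw [Fin.val_zero, pow_zero, one_smul]; rfl
  | succ l ih =>
    rw [hidden_succ, ih, hidden_succ, Fin.val_succ, Fin.val_castSucc, pow_succ']
    exact conv_smul_smul t _ (w.layer l) _

theorem sqNormSum_eq_sum_blocks [SeminormedAddCommGroup R] (w : Weights R C K H W) :
    w.sqNormSum = ∑ i, ∑ j, (w.blocks i j).sqNormSum := by
  simp only [sqNormSum, MatrixChain.sqNormSum, sqNorm_eq_sum_norm_block, Finset.sum_add_distrib]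
  congr 1
  rw [Finset.sum_comm]
  exact Finset.sum_congr rfl fun i _ => Finset.sum_comm

end Blocks

variable {n K H W : ℕ} [NeZero H] [NeZero W] {C : Fin (n + 1) → ℕ}

theorem freqNet_eq_contract (w : Weights ℂ C K H W) (x : Image ℂ (C 0) H W) :
    w.freqNet x = contract w.endToEnd x := by
  have h : ∀ i j, (block w.final i j *ᵥ fun d => w.freqHidden x (Fin.last n) d i j)
      = block w.endToEnd i j *ᵥ fun d => x d i j := fun i j => by
    rw [freqHidden_eq_mulVec, Matrix.mulVec_mulVec]
    rfl
  funext c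
  exact Finset.sum_congr rfl fun i _ => Finset.sum_congr rfl fun j _ => congrFun (h i j) c

theorem sqNormSum_dft (w : Weights ℝ C K H W) : w.dft.sqNormSum = w.sqNormSum := by
  simp only [sqNormSum, dft, sqNorm_dftTensor]

theorem exists_blocks_dft_eq_iff
    {f : ZMod H → ZMod W → MatrixChain ℂ (fun l => Fin (C l)) (Fin K)} :
    (∃ w : Weights ℝ C K H W, w.dft.blocks = f) ↔
      ∀ i j, f (-i) (-j) = (f i j).map (starRingEnd ℂ) := by
  constructor
  · rintro ⟨w, rfl⟩ i j
    simp only [blocks, MatrixChain.map, dft, exists_eq_dftTensor_iff.1 ⟨_, rfl⟩ i j]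
  · intro hf
    choose layer hlayer using fun l => exists_eq_dftTensor_iff
      (v := fun c i j d => (f i j).layer l c d).2 fun i j =>
        congrArg (fun M => M.layer l) (hf i j)
    obtain ⟨final, hfinal⟩ := exists_eq_dftTensor_iff
      (v := fun c i j d => (f i j).final c d).2 fun i j => congrArg MatrixChain.final (hf i j)
    refine ⟨⟨layer, final⟩, ?_⟩
    funext i j
    simp only [blocks, dft, ← hlayer, ← hfinal]
    rfl

theorem endToEnd_dft_mem_feasible (w : Weights ℝ C K H W) :
    w.dft.endToEnd ∈ feasible C K H W := by
  refine ⟨exists_eq_dftTensor_iff.2 fun i j => ?_, w.dft.rank_block_endToEnd_le⟩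
  rw [block_endToEnd, exists_blocks_dft_eq_iff.1 ⟨w, rfl⟩ i j, MatrixChain.map_prod]
  rfl

theorem mul_schattenPenalty_endToEnd_le_sqNormSum (w : Weights ℂ C K H W) :
    ((n + 1 : ℕ) : ℝ) * schattenPenalty (n + 1) w.endToEnd ≤ w.sqNormSum := by
  simp only [sqNormSum_eq_sum_blocks, schattenPenalty, Finset.mul_sum, block_endToEnd]
  gcongr
  exact MatrixChain.mul_schatten_rpow_le_sqNormSum _

-- The optimal factors at the frequencies `q` and `-q` have to be conjugate to each other in order
-- to come from real weights, so they must be chosen real where `q = -q`.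
theorem exists_of_mem_feasible {v : Tensor ℂ K H W (C 0)} (hv : v ∈ feasible C K H W) :
    ∃ w : Weights ℝ C K H W, w.dft.endToEnd = v ∧
      w.dft.sqNormSum = ((n + 1 : ℕ) : ℝ) * schattenPenalty (n + 1) v := by
  obtain ⟨hdft, hrank⟩ := hv
  have hneg : ∀ q : ZMod H × ZMod W, block v (-q).1 (-q).2 = (block v q.1 q.2).map conj :=
    fun q => exists_eq_dftTensor_iff.1 hdft q.1 q.2
  obtain ⟨f, hf⟩ := exists_equivariant_choice
    (P := fun (q : ZMod H × ZMod W) (M : MatrixChain ℂ (fun l => Fin (C l)) (Fin K)) =>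
      M.prod = block v q.1 q.2 ∧ M.sqNormSum = ((n + 1 : ℕ) : ℝ) *
        schatten (2 / ((n + 1 : ℕ) : ℝ)) (block v q.1 q.2) ^ (2 / ((n + 1 : ℕ) : ℝ)))
    (τ := MatrixChain.map (starRingEnd ℂ))
    neg_involutive (MatrixChain.map_map_of_involutive Complex.conj_conj)
    (fun q M hM => ⟨by rw [hneg, MatrixChain.map_prod, hM.1], by
      rw [hneg, schatten_map_conj_rpow (by positivity), MatrixChain.sqNormSum_map RCLike.norm_conj,
        hM.2]⟩)
    (fun q => by
      obtain ⟨M, hprod, hnorm, hreal⟩ := exists_matrixChain_of_rank_le (C := C)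
        fun l => (hrank q.1 q.2).trans ((min_le_left _ _).trans (ciInf_le' C l))
      exact ⟨M, ⟨hprod, hnorm⟩, fun hq => hreal (by rw [← hneg, hq])⟩)
  obtain ⟨w, hw⟩ := (exists_blocks_dft_eq_iff (f := fun i j => f (i, j))).2
    fun i j => (hf (i, j)).2
  refine ⟨w, ?_, ?_⟩
  · funext c i j d
    have hblock : (w.dft.blocks i j).prod = block v i j := by rw [hw, (hf (i, j)).1.1]
    exact congrFun (congrFun hblock c) d
  · simp only [sqNormSum_eq_sum_blocks, hw, (hf _).1.2, schattenPenalty, Finset.mul_sum]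

theorem dftImage_hidden (w : Weights ℝ C K H W) (x : Image ℝ (C 0) H W) (l : Fin (n + 1)) :
    dftImage (w.hidden x l)
      = (√((H : ℝ) * W) : ℂ) ^ (l : ℕ) • w.dft.freqHidden (dftImage x) l := by
  induction l using Fin.induction with
  | zero => rw [Fin.val_zero, pow_zero, one_smul]; rfl
  | succ l ih =>
    rw [hidden_succ, dftImage_conv, ih, pointwise_smul, smul_smul, Fin.val_succ, pow_succ']
    rfl

theorem cnn_scale (t : ℝ) (w : Weights ℝ C K H W) (x : Image ℝ (C 0) H W) :
    (w.scale t).cnn x = t ^ (n + 1) • w.cnn x := by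
  change contract (t • w.final) ((w.scale t).hidden x (Fin.last n)) = _
  rw [hidden_scale, contract_smul_smul, Fin.val_last, pow_succ']
  rfl

theorem cnn_eq_mul_freqNet_reflectFinal (w : Weights ℝ C K H W) (x : Image ℝ (C 0) H W)
    (k : Fin K) :
    (w.cnn x k : ℂ) = (√((H : ℝ) * W) : ℂ) ^ n * w.reflectFinal.dft.freqNet (dftImage x) k := by
  have h := contract_dftTensor_dftImage (reflect w.final) (w.hidden x (Fin.last n)) k
  rw [reflect_involutive, dftImage_hidden, Fin.val_last, ← one_smul ℂ (dftTensor _),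
    contract_smul_smul, one_mul] at h
  exact h.symm

end Weights

variable {n N K H W : ℕ} [NeZero H] [NeZero W] {C : Fin (n + 1) → ℕ}

theorem contract_dftImage_im {v : Tensor ℂ K H W (C 0)} (hv : v ∈ feasible C K H W)
    (z : Image ℝ (C 0) H W) (k : Fin K) : (contract v (dftImage z) k).im = 0 := by
  obtain ⟨u, rfl⟩ := hv.1
  rw [contract_dftTensor_dftImage, Complex.ofReal_im]

theorem Weights.freqNet_dft_dftImage_im (w : Weights ℝ C K H W) (z : Image ℝ (C 0) H W)
    (k : Fin K) : (w.dft.freqNet (dftImage z) k).im = 0 := by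
  rw [freqNet_eq_contract]
  exact contract_dftImage_im w.endToEnd_dft_mem_feasible z k

theorem equivalentMinimization_freqNet
    (loss : (Fin N → Fin K → ℝ) → (Fin N → Fin K → ℝ) → ℝ)
    (x : Fin N → Image ℝ (C 0) H W) (y : Fin N → Fin K → ℝ) {lam : ℝ} (hlam : 0 ≤ lam) :
    EquivalentMinimization
      (fun w : Weights ℝ C K H W =>
        loss (fun s k => (w.dft.freqNet (dftImage (x s)) k).re) y + lam * w.dft.sqNormSum)
      (feasible C K H W)
      (fun v => loss (fun s k => (contract v (dftImage (x s)) k).re) y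
          + lam * ((n + 1 : ℕ) : ℝ) * schattenPenalty (n + 1) v)
      (fun w v => ∀ z, w.dft.freqNet (dftImage z) = contract v (dftImage z)) := by
  simp only [Weights.freqNet_eq_contract, contract_dftImage_eq_iff, mul_assoc]
  refine .of_isLeast (fun w => ⟨w.dft.endToEnd, ⟨w.endToEnd_dft_mem_feasible, rfl⟩,
    fun v hv => hv.2.symm⟩) fun v hv => ⟨?_, ?_⟩
  · obtain ⟨w, rfl, hnorm⟩ := Weights.exists_of_mem_feasible hv
    exact ⟨w, rfl, by simp only [hnorm]⟩
  · rintro _ ⟨w, rfl, rfl⟩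
    exact add_le_add le_rfl
      (mul_le_mul_of_nonneg_left w.dft.mul_schattenPenalty_endToEnd_le_sqNormSum hlam)

theorem Weights.freqNet_reflectFinal_scale {t : ℝ} (ht : t ^ (n + 1) = √((H : ℝ) * W) ^ n)
    (w : Weights ℝ C K H W) (x : Image ℝ (C 0) H W) (k : Fin K) :
    (w.scale t).reflectFinal.dft.freqNet (dftImage x) k = (w.cnn x k : ℂ) := by
  have hHW : (√((H : ℝ) * W) : ℂ) ^ n ≠ 0 := by
    rw [← sqrt_card_spatial]
    exact pow_ne_zero n (Complex.ofReal_ne_zero.2 (sqrt_card_ne_zero _))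
  apply mul_left_cancel₀ hHW
  rw [← cnn_eq_mul_freqNet_reflectFinal, cnn_scale, ht, Pi.smul_apply, smul_eq_mul,
    Complex.ofReal_mul, Complex.ofReal_pow]

-- The `n` convolutions contribute a factor `√(HW) ^ n` to the output, which is distributed evenly
-- over the `n + 1` layers.
theorem equivalentMinimization_cnn
    (loss : (Fin N → Fin K → ℝ) → (Fin N → Fin K → ℝ) → ℝ)
    (x : Fin N → Image ℝ (C 0) H W) (y : Fin N → Fin K → ℝ) {lam : ℝ} (hlam : 0 ≤ lam) :
    EquivalentMinimization
      (fun w : Weights ℝ C K H W => loss (fun s => w.cnn (x s)) y + lam * w.sqNormSum)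
      (feasible C K H W)
      (fun v => loss (fun s k => (contract v (dftImage (x s)) k).re) y
          + lam * ((n + 1 : ℕ) : ℝ)
            * (((H : ℝ) * (W : ℝ)) ^ (-((n : ℝ) / ((n + 1 : ℕ) : ℝ)))
              * schattenPenalty (n + 1) v))
      (fun w v => ∀ z k, (w.cnn z k : ℂ) = contract v (dftImage z) k) := by
  have hHW : (0 : ℝ) < (H : ℝ) * W := mul_pos (Nat.cast_pos.2 (NeZero.pos H))
    (Nat.cast_pos.2 (NeZero.pos W))
  set α : ℝ := (n : ℝ) / ((n + 1 : ℕ) : ℝ) with hα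
  set t : ℝ := √((H : ℝ) * W) ^ α with ht
  have htpos : 0 < t := Real.rpow_pos_of_pos (Real.sqrt_pos.2 hHW) α
  have htpow : t ^ (n + 1) = √((H : ℝ) * W) ^ n := by
    rw [ht, ← Real.rpow_natCast, ← Real.rpow_mul (Real.sqrt_nonneg _), hα,
      div_mul_cancel₀ _ (Nat.cast_ne_zero.2 n.succ_ne_zero), Real.rpow_natCast]
  have htsq : ((H : ℝ) * W) ^ (-α) * ‖t‖ ^ 2 = 1 := by
    rw [Real.norm_of_nonneg htpos.le, ht, Real.rpow_pow_comm (Real.sqrt_nonneg _),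
      Real.sq_sqrt hHW.le, ← Real.rpow_add hHW, neg_add_cancel, Real.rpow_zero]
  have h := (equivalentMinimization_freqNet (C := C) loss x y
    (mul_nonneg hlam (Real.rpow_nonneg hHW.le (-α)))).comp
    (Weights.reflectFinal_involutive.surjective.comp (Weights.scale_surjective htpos.ne'))
  convert h using 1
  · funext w
    simp only [Function.comp_apply, Weights.freqNet_reflectFinal_scale htpow, Complex.ofReal_re,
      Weights.sqNormSum_dft, Weights.sqNormSum_reflectFinal, Weights.sqNormSum_scale]
    linear_combination (-lam * w.sqNormSum) * htsq
  · funext v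
    ring
  · funext w v
    simp only [Function.comp_apply, funext_iff, Weights.freqNet_reflectFinal_scale htpow]

end Network

end LinearCNN

end

theorem mainTheorem1 {n K H W N : ℕ} [NeZero H] [NeZero W] (C : Fin (n + 1) → ℕ)
    (loss : (Fin N → Fin K → ℝ) → (Fin N → Fin K → ℝ) → ℝ)
    (x : Fin N → LinearCNN.Image ℝ (C 0) H W) (y : Fin N → Fin K → ℝ)
    (lam : ℝ) (hlam : 0 ≤ lam) :
    -- all outputs that enter the loss below are real
    (∀ v ∈ LinearCNN.feasible C K H W, ∀ z k,
      (LinearCNN.contract v (LinearCNN.dftImage z) k).im = 0) ∧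
    (∀ (w : LinearCNN.Weights ℝ C K H W) z k,
      (w.dft.freqNet (LinearCNN.dftImage z) k).im = 0) ∧
    -- the frequency space network with penalty on the Fourier transforms of the weights
    LinearCNN.EquivalentMinimization
      (fun w : LinearCNN.Weights ℝ C K H W =>
        loss (fun s k => (w.dft.freqNet (LinearCNN.dftImage (x s)) k).re) y
          + lam * w.dft.sqNormSum)
      (LinearCNN.feasible C K H W)
      (fun v => loss (fun s k => (LinearCNN.contract v (LinearCNN.dftImage (x s)) k).re) y
          + lam * ((n + 1 : ℕ) : ℝ) * LinearCNN.schattenPenalty (n + 1) v)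
      (fun w v => ∀ z, w.dft.freqNet (LinearCNN.dftImage z)
          = LinearCNN.contract v (LinearCNN.dftImage z)) ∧
    -- the convolutional network with penalty on the weights
    LinearCNN.EquivalentMinimization
      (fun w : LinearCNN.Weights ℝ C K H W =>
        loss (fun s => w.cnn (x s)) y + lam * w.sqNormSum)
      (LinearCNN.feasible C K H W)
      (fun v => loss (fun s k => (LinearCNN.contract v (LinearCNN.dftImage (x s)) k).re) y
          + lam * ((n + 1 : ℕ) : ℝ)
            * (((H : ℝ) * (W : ℝ)) ^ (-((n : ℝ) / ((n + 1 : ℕ) : ℝ)))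
              * LinearCNN.schattenPenalty (n + 1) v))
      (fun w v => ∀ z k, (w.cnn z k : ℂ) = LinearCNN.contract v (LinearCNN.dftImage z) k) :=
  ⟨fun _ hv => LinearCNN.contract_dftImage_im hv, fun w => w.freqNet_dft_dftImage_im,
    LinearCNN.equivalentMinimization_freqNet loss x y hlam,
    LinearCNN.equivalentMinimization_cnn loss x y hlam⟩
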